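/- **Notation.** For a complex number $w=se^{i\varphi}$ with $s\ge 0$ and $-\pi<\varphi\le\pi$, put $w^{1/n}=s^{1/n}e^{i\varphi/n}$ (and $\sqrt w=w^{1/2}$). For integers $n\ge 3$, $r\ge 0$ let $X_{n,r}(x)={}_2F_1(-r,-r-1/n;1-1/n;x)\in\mathbb{Q}[x]$, let $D_{n,r}$ be the smallest positive integer such that $D_{n,r}X_{n,r}(x)$ has integer coefficients, and for a positive integer $d$ let $N_{d,n,r}$ be the greatest common divisor of the numerators of the coefficients of $X_{n,r}(1-dx)$. Put $\mathcal{N}_{d,n}=\prod_{p\mid n}p^{\min(v_p(d),\,v_p(n)+1/(p-1))}$, the product being over the primes $p$ dividing $n$ and $v_p$ being the $p$-adic valuation. **Theorem 2.1.** Let $\mathbb{K}\subset\mathbb{C}$ be either $\mathbb{Q}$ or an imaginary quadratic field and let $\beta_1$ be an algebraic integer with $[\mathbb{K}(\beta_1):\mathbb{K}]\le 2$. If $\mathbb{K}=\mathbb{Q}$ or $\mathbb{K}(\beta_1)=\mathbb{K}$, let $\tau=1$; otherwise let $\tau$ be an algebraic integer in $\mathbb{K}$ such that $\mathbb{K}(\beta_1)=\mathbb{K}(\sqrt\tau)$.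 If $\beta_1\in\mathbb{K}$, let $\beta_2,\gamma_1,\gamma_2\in\mathbb{K}$ with $\gamma_1,\gamma_2$ non-zero, $\beta_2\ne\beta_1$ and $\beta_2$ an algebraic integer. If $[\mathbb{K}(\beta_1):\mathbb{K}]=2$, let $\beta_2$ be the algebraic conjugate of $\beta_1$ over $\mathbb{K}$, $\gamma_1\in\mathbb{K}(\beta_1)$, and $\gamma_2$ the algebraic conjugate of $\gamma_1$ over $\mathbb{K}$ (that is, $\beta_2=\sigma(\beta_1)$ and $\gamma_2=\sigma(\gamma_1)$ for the non-trivial $\mathbb{K}$-automorphism $\sigma$ of $\mathbb{K}(\beta_1)$). For an algebraic integer $x\in\mathbb{K}$ and a rational integer $n\ge 3$, put $$U(x)=-\gamma_2(x-\beta_2)^n,\quad Z(x)=\gamma_1(x-\beta_1)^n,\quad W(x)=\frac{Z(x)}{U(x)},\quad \mathcal{A}(x)=\frac{\beta_1(x-\beta_2)W(x)^{1/n}-\beta_2(x-\beta_1)}{(x-\beta_2)W(x)^{1/n}-(x-\beta_1)}.$$ Let $g$ be a non-zero algebraic number such that $U(x)/g$ and $Z(x)/g$ are algebraic integers (not necessarily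 in $\mathbb{K}(\beta_1)$). For each integer $r\ge 0$ let $h_r$ be a non-zero algebraic integer with $h_r/g^r\in\mathbb{K}$ and $|h_r|\le h$, for some fixed positive real number $h$. Let $d$ be the largest positive rational integer such that $(U(x)-Z(x))/(dg)$ is an algebraic integer, and let $\mathcal{C}_n,\mathcal{D}_n$ be positive real numbers such that $$\max\left(1,\frac{\Gamma(1-1/n)\,r!}{\Gamma(r+1-1/n)},\frac{n\,\Gamma(r+1+1/n)}{\Gamma(1/n)\,r!}\right)\frac{D_{n,r}}{N_{d,n,r}}<\mathcal{C}_n\left(\frac{\mathcal{D}_n}{\mathcal{N}_{d,n}}\right)^r$$ for all integers $r\ge 0$. Put $$E=\frac{|g|\,\mathcal{N}_{d,n}}{\mathcal{D}_n}\left\{\min\left(\left|\sqrt{U(x)}-\sqrt{Z(x)}\right|,\left|\sqrt{U(x)}+\sqrt{Z(x)}\right|\right)\right\}^{-2},$$ $$Q=\frac{\mathcal{D}_n}{|g|\,\mathcal{N}_{d,n}}\left\{\max\left(\left|\sqrt{U(x)}-\sqrt{Z(x)}\right|,\left|\sqrt{U(x)}+\sqrt{Z(x)}\right|\right)\right\}^{2},\qquad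 \kappa=\frac{\log Q}{\log E},$$ $$c=4h|\sqrt\tau|\left(|x-\beta_1|+|x-\beta_2|\right)\mathcal{C}_nQ\cdot\max\left(1,\;5h|\sqrt\tau|\left|1-W(x)^{1/n}\right||x-\beta_2|\,|\mathcal{A}(x)-\beta_1|\,\mathcal{C}_nE\right)^{\kappa}.$$ If $E>1$ and either $0<W(x)<1$ (in particular $W(x)$ real) or $|W(x)|=1$ with $W(x)\ne -1$, then $\mathcal{A}(x)$ is well defined (its denominator is non-zero), and $$\left|\mathcal{A}(x)-\frac pq\right|>\frac{1}{c\,|q|^{\kappa+1}}$$ for all algebraic integers $p$ and $q$ in $\mathbb{K}$ with $q\ne 0$. -/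

import Mathlib

open Polynomial
open scoped IntermediateField

namespace ThueHypergeometric

noncomputable section

/-- `K`, a subfield of `ℂ`, is `ℚ` or an imaginary quadratic field. -/
def IsRatOrImagQuadratic (K : IntermediateField ℚ ℂ) : Prop :=
  K = ⊥ ∨ (Module.finrank ℚ K = 2 ∧ ∃ z ∈ K, z.im ≠ 0)

/-- The principal `n`-th root: `s * exp (i φ)` with `s ≥ 0` and `-π < φ ≤ π` is sent to
`s ^ (1 / n) * exp (i φ / n)`. -/
def nthRoot (n : ℕ) (w : ℂ) : ℂ := w ^ (1 / (n : ℂ))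

/-- The polynomial `X_{n,r}(x) = ₂F₁(-r, -r - 1/n; 1 - 1/n; x)`, with rational coefficients
(the hypergeometric series terminates at `x ^ r`). -/
def hypX (n r : ℕ) : ℚ[X] :=
  ∑ k ∈ Finset.range (r + 1),
    C (ordinaryHypergeometricCoefficient
        (-(r : ℚ)) (-(r : ℚ) - 1 / (n : ℚ)) (1 - 1 / (n : ℚ)) k) * X ^ k

/-- `D_{n,r}`: the smallest positive integer `D` such that `D * X_{n,r}(x)` has integer
coefficients. -/
def denomX (n r : ℕ) : ℕ :=
  sInf {D : ℕ | 0 < D ∧ ∀ k : ℕ, ∃ z : ℤ, (D : ℚ) * (hypX n r).coeff k = (z : ℚ)}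

/-- `N_{d,n,r}`: the greatest common divisor of the numerators (in lowest terms) of the
coefficients of `X_{n,r}(1 - d x)`, a polynomial of degree at most `r`. -/
def numerX (d n r : ℕ) : ℕ :=
  (Finset.range (r + 1)).gcd
    fun k => (((hypX n r).comp (1 - C (d : ℚ) * X)).coeff k).num.natAbs

/-- `𝒩_{d,n} = ∏_{p ∣ n} p ^ min (v_p(d), v_p(n) + 1 / (p - 1))`. -/
def calN (d n : ℕ) : ℝ :=
  ∏ p ∈ n.primeFactors,
    (p : ℝ) ^ min (padicValNat p d : ℝ) ((padicValNat p n : ℝ) + 1 / ((p : ℝ) - 1))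

end

end ThueHypergeometric

/-!
The approximations come from the Padé approximants of `z ^ (1 / n)` at `z = 1`. Put
`A_r = U ^ r X_{n,r}(Z / U)` and `B_r = Z ^ r X_{n,r}(U / Z)`, and write `ω` for the root of
`W = Z / U`. Then `A_r - ω B_r` is a constant times an integral
(`factorial_sq_div_mul_jacobiSum_sub`), which is geometrically small with ratio `min ‖√U ± √Z‖ ^ 2`,
while `A_r` and `B_r` grow at most with ratio `max ‖√U ± √Z‖ ^ 2`. The quotients of
`P_r = β₁ (x - β₂) A_r - β₂ (x - β₁) B_r` by `R_r = (x - β₂) A_r - (x - β₁) B_r` therefore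
approximate `𝒜(x)`; consecutive ones differ (`hypForm_casoratian_ne_zero`).

After multiplication by `(D_{n,r} / N_{d,n,r}) (h_r / g ^ r)` the numbers `q P_r - p R_r` become
algebraic integers, because `Z / g = U / g - d w` with `w` integral and the polynomial
`X_{n,r}(1 - d x)` is divisible by `N_{d,n,r}`. The non-trivial automorphism of `K(β₁)`, if there is
one, maps them to plus or minus themselves, so their squares lie in `K` (`sq_mem_of_conjugate`), and
a non-zero one has absolute value at least `1` (`one_le_norm_of_sq_mem`). In particular the
multiplier `√τ` is only needed for `1 ≤ ‖√τ‖`. The measure follows in the usual way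
(`le_mul_norm_sub_div`). The denominator of `𝒜(x)` does not vanish, since otherwise `R_r` would be
as small as the remainder, hence `0`.

The size of `A_r` and `B_r` is estimated in two ways. On `‖W‖ = 1` the three-term recurrence of
Jacobi polynomials propagates the bound (`norm_jacobiForm_le_of_norm_eq`). On `0 < W < 1` the
coefficients are compared with binomial coefficients (`jacobiForm_sq_le`); this fails for `B_r` when
`W` is very small. Such `W` are excluded by `E > 1`: `D_{n,r}` grows exponentially (`pow_le_denomX`)
and `N_{d,n,r} ≤ d ^ r`, so that `𝒟_n d / 𝒩_{d,n} ≥ 6 / 5`, whereas `E > 1` and `‖U - Z‖ ≥ d ‖g‖`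
give `𝒟_n d / 𝒩_{d,n} < (1 + √W) / (1 - √W)`.
-/

namespace ThueHypergeometric

open Finset

/-! ### Jacobi forms and their recurrence -/

section Jacobi

variable {F : Type*} [Field F]

/-- The reciprocal of `k! (1 + a)(2 + a) ⋯ (k + a)`; the coefficients of a Jacobi form are products
of two such weights. -/
noncomputable def jacobiWeight (a : F) (k : ℕ) : F :=
  ((k.factorial : F) * ∏ i ∈ range k, ((i : F) + 1 + a))⁻¹

/-- The binary form `∑ w_{-a}(k) w_a(r - k) u ^ k v ^ (r - k)`, where `w_a` is `jacobiWeight a`.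
This is the hypergeometric polynomial `₂F₁(-r, -r - a; 1 - a; u / v) v ^ r` up to a constant factor;
interchanging `u` and `v` gives the reciprocal polynomial. -/
noncomputable def jacobiSum (a : F) (r : ℕ) (u v : F) : F :=
  ∑ x ∈ antidiagonal r, jacobiWeight (-a) x.1 * jacobiWeight a x.2 * u ^ x.1 * v ^ x.2

/-- `jacobiSum` scaled to have the coefficients `C(r - a, r - k) C(r + a, k)`, hence the value
`C(2r, r)` at `(1, 1)`: a homogeneous form of the Jacobi polynomial `P_r^{(-a, a)}`. -/
noncomputable def jacobiForm (a : F) (r : ℕ) (u v : F) : F :=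
  (∏ i ∈ range r, ((i : F) + 1 - a)) * (∏ i ∈ range r, ((i : F) + 1 + a)) * jacobiSum a r u v

theorem jacobiWeight_zero (a : F) : jacobiWeight a 0 = 1 := by simp [jacobiWeight]

theorem jacobiWeight_succ [CharZero F] {a : F} (ha : ∀ i : ℕ, (i : F) + 1 + a ≠ 0) (k : ℕ) :
    ((k : F) + 1) * ((k : F) + 1 + a) * jacobiWeight a (k + 1) = jacobiWeight a k := by
  have h1 : ((k : F) + 1) ≠ 0 := by exact_mod_cast Nat.succ_ne_zero k
  have h2 := ha k
  simp only [jacobiWeight, prod_range_succ, Nat.factorial_succ, Nat.cast_mul, Nat.cast_add,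
    Nat.cast_one, mul_inv]
  field_simp

theorem map_jacobiWeight {F' : Type*} [Field F'] (f : F →+* F') (a : F) (k : ℕ) :
    f (jacobiWeight a k) = jacobiWeight (f a) k := by
  simp [jacobiWeight]

theorem map_jacobiForm {F' : Type*} [Field F'] (f : F →+* F') (a : F) (r : ℕ) (u v : F) :
    f (jacobiForm a r u v) = jacobiForm (f a) r (f u) (f v) := by
  simp [jacobiForm, jacobiSum, map_jacobiWeight]

theorem jacobiForm_zero (a u v : F) : jacobiForm a 0 u v = 1 := by
  simp [jacobiForm, jacobiSum, jacobiWeight_zero]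

theorem jacobiForm_one {a : F} (h₁ : 1 + a ≠ 0) (h₂ : 1 - a ≠ 0) (u v : F) :
    jacobiForm a 1 u v = (1 + a) * u + (1 - a) * v := by
  have h₃ : 1 + -a ≠ 0 := by rwa [← sub_eq_add_neg]
  simp [jacobiForm, jacobiSum, jacobiWeight, Finset.Nat.antidiagonal_succ]
  field_simp
  ring

section recurrence

variable [CharZero F] {a : F}

/-- A factor `k (k - a)` turns the weight of index `k` into that of index `k - 1`: multiplying the
coefficients of a form of degree `m + 1` by it gives `u` times the form of degree `m`. -/
theorem sum_antidiagonal_shift_left (h₂ : ∀ i : ℕ, (i : F) + 1 - a ≠ 0)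
    (g : ℕ × ℕ → F) (m : ℕ) (u v : F) :
    ∑ x ∈ antidiagonal (m + 1), (x.1 : F) * (x.1 - a) * g x *
        (jacobiWeight (-a) x.1 * jacobiWeight a x.2 * u ^ x.1 * v ^ x.2)
      = u * ∑ x ∈ antidiagonal m, g (x.1 + 1, x.2) *
        (jacobiWeight (-a) x.1 * jacobiWeight a x.2 * u ^ x.1 * v ^ x.2) := by
  rw [Finset.Nat.sum_antidiagonal_succ, mul_sum]
  simp only [Nat.cast_zero, zero_mul, zero_add]
  refine sum_congr rfl fun x _ => ?_
  rw [← jacobiWeight_succ (a := -a) (fun i => by rw [← sub_eq_add_neg]; exact h₂ i) x.1]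
  push_cast
  ring

/-- The mirror image of `sum_antidiagonal_shift_left`, for the exponent of `v`. -/
theorem sum_antidiagonal_shift_right (h₁ : ∀ i : ℕ, (i : F) + 1 + a ≠ 0)
    (g : ℕ × ℕ → F) (m : ℕ) (u v : F) :
    ∑ x ∈ antidiagonal (m + 1), (x.2 : F) * (x.2 + a) * g x *
        (jacobiWeight (-a) x.1 * jacobiWeight a x.2 * u ^ x.1 * v ^ x.2)
      = v * ∑ x ∈ antidiagonal m, g (x.1, x.2 + 1) *
        (jacobiWeight (-a) x.1 * jacobiWeight a x.2 * u ^ x.1 * v ^ x.2) := by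
  rw [Finset.Nat.sum_antidiagonal_succ', mul_sum]
  simp only [Nat.cast_zero, zero_mul, zero_add]
  refine sum_congr rfl fun x _ => ?_
  rw [← jacobiWeight_succ (a := a) h₁ x.2]
  push_cast
  ring

/-- The three-term recurrence. By the two shift lemmas every term is a sum over the same
antidiagonal `k + j = l + 2`, where it becomes a polynomial identity in `k`, `j` and `a`. -/
theorem jacobiSum_recurrence (h₁ : ∀ i : ℕ, (i : F) + 1 + a ≠ 0)
    (h₂ : ∀ i : ℕ, (i : F) + 1 - a ≠ 0) (l : ℕ) (u v : F) :
    ((l : F) + 1) * (l + 2) * ((l + 2) ^ 2 - a ^ 2) * jacobiSum a (l + 2) u v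
      = (l + 1) * (2 * l + 3) * (u + v) * jacobiSum a (l + 1) u v
        - (u - v) ^ 2 * jacobiSum a l u v := by
  have s1 := sum_antidiagonal_shift_left h₂ (fun _ => 1) (l + 1) u v
  have s2 := sum_antidiagonal_shift_right h₁ (fun _ => 1) (l + 1) u v
  have s3 := sum_antidiagonal_shift_left h₂
    (fun x => ((x.1 : F) - 1) * (x.1 - 1 - a)) (l + 1) u v
  have s4 := sum_antidiagonal_shift_right h₁
    (fun x => ((x.2 : F) - 1) * (x.2 - 1 + a)) (l + 1) u v
  have s5 := sum_antidiagonal_shift_left h₂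
    (fun x => (x.2 : F) * (x.2 + a)) (l + 1) u v
  have t3 := sum_antidiagonal_shift_left h₂ (fun _ => 1) l u v
  have t4 := sum_antidiagonal_shift_right h₁ (fun _ => 1) l u v
  simp only [mul_one, one_mul] at s1 s2 t3 t4
  simp only [Nat.cast_add, Nat.cast_one, add_sub_cancel_right] at s3 s4 s5
  rw [t3] at s3
  rw [t4] at s4 s5
  have key : ((l : F) + 1) * (l + 2) * ((l + 2) ^ 2 - a ^ 2) * jacobiSum a (l + 2) u v
      = (l + 1) * (2 * l + 3) * (u * jacobiSum a (l + 1) u v + v * jacobiSum a (l + 1) u v)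
        - (u * (u * jacobiSum a l u v) - 2 * (u * (v * jacobiSum a l u v))
          + v * (v * jacobiSum a l u v)) := by
    simp only [jacobiSum]
    rw [← s1, ← s2, ← s3, ← s4, ← s5]
    simp only [mul_sum, ← sum_add_distrib, ← sum_sub_distrib]
    refine sum_congr rfl fun x hx => ?_
    have hl : (l : F) = x.1 + x.2 - 2 := by
      have := mem_antidiagonal.1 hx
      rw [eq_sub_iff_add_eq]
      exact_mod_cast this.symm
    rw [hl]
    ring
  rw [key]
  ring

theorem jacobiForm_recurrence (h₁ : ∀ i : ℕ, (i : F) + 1 + a ≠ 0)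
    (h₂ : ∀ i : ℕ, (i : F) + 1 - a ≠ 0) (l : ℕ) (u v : F) :
    ((l : F) + 1) * (l + 2) * jacobiForm a (l + 2) u v
      = (l + 1) * (2 * l + 3) * (u + v) * jacobiForm a (l + 1) u v
        - ((l + 1) ^ 2 - a ^ 2) * (u - v) ^ 2 * jacobiForm a l u v := by
  have h := jacobiSum_recurrence h₁ h₂ l u v
  simp only [jacobiForm, prod_range_succ]
  push_cast
  linear_combination (∏ i ∈ range l, ((i : F) + 1 - a)) * (∏ i ∈ range l, ((i : F) + 1 + a))
    * ((l : F) + 1 - a) * (l + 1 + a) * h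

/-- Consecutive forms are not proportional under `u ↔ v`: the recurrence is symmetric in `u` and
`v`, so the Casoratian gains a non-zero multiple of `(u - v) ^ 2` at each step. -/
theorem jacobiForm_casoratian_ne_zero (h₁ : ∀ i : ℕ, (i : F) + 1 + a ≠ 0)
    (h₂ : ∀ i : ℕ, (i : F) + 1 - a ≠ 0) (ha : a ≠ 0) {u v : F} (huv : u ≠ v) (r : ℕ) :
    jacobiForm a r u v * jacobiForm a (r + 1) v u
      - jacobiForm a (r + 1) u v * jacobiForm a r v u ≠ 0 := by
  induction r with
  | zero =>
    have e₁ : 1 + a ≠ 0 := by simpa using h₁ 0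
    have e₂ : 1 - a ≠ 0 := by simpa using h₂ 0
    rw [jacobiForm_zero, jacobiForm_zero, zero_add, jacobiForm_one e₁ e₂, jacobiForm_one e₁ e₂]
    have : 1 * ((1 + a) * v + (1 - a) * u) - ((1 + a) * u + (1 - a) * v) * 1
      = 2 * a * (v - u) := by ring
    rw [this]
    exact mul_ne_zero (mul_ne_zero two_ne_zero ha) (sub_ne_zero.2 huv.symm)
  | succ l ih =>
    have r₁ := jacobiForm_recurrence h₁ h₂ l u v
    have r₂ := jacobiForm_recurrence h₁ h₂ l v u
    intro h
    have h4 : ((l : F) + 1 - a) * (l + 1 + a) * (u - v) ^ 2 * (jacobiForm a l u v *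
        jacobiForm a (l + 1) v u - jacobiForm a (l + 1) u v * jacobiForm a l v u) = 0 := by
      linear_combination ((l : F) + 1) * (l + 2) * h - jacobiForm a (l + 1) u v * r₂
        + jacobiForm a (l + 1) v u * r₁
    exact mul_ne_zero (mul_ne_zero (mul_ne_zero (h₂ l) (h₁ l))
      (pow_ne_zero _ (sub_ne_zero.2 huv))) ih h4

theorem jacobiForm_one_one (h₁ : ∀ i : ℕ, (i : F) + 1 + a ≠ 0)
    (h₂ : ∀ i : ℕ, (i : F) + 1 - a ≠ 0) (r : ℕ) :
    jacobiForm a r 1 1 = (Nat.centralBinom r : F) := by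
  induction r with
  | zero => simp [jacobiForm_zero]
  | succ r ih =>
    rcases r with _ | l
    · have e₁ : 1 + a ≠ 0 := by simpa using h₁ 0
      have e₂ : 1 - a ≠ 0 := by simpa using h₂ 0
      rw [zero_add, jacobiForm_one e₁ e₂]
      simp [Nat.centralBinom]
      ring
    · have r₁ := jacobiForm_recurrence h₁ h₂ l 1 1
      rw [ih] at r₁
      have h3 : ((l + 1 + 1 : ℕ) : F) * (Nat.centralBinom (l + 1 + 1) : F)
          = 2 * (2 * (l + 1 : ℕ) + 1) * (Nat.centralBinom (l + 1) : F) := by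
        exact_mod_cast Nat.succ_mul_centralBinom_succ (l + 1)
      have n1 : ((l : F) + 1) ≠ 0 := by exact_mod_cast Nat.succ_ne_zero l
      have n2 : ((l : F) + 2) ≠ 0 := by exact_mod_cast Nat.succ_ne_zero (l + 1)
      apply mul_left_cancel₀ (mul_ne_zero n1 n2)
      push_cast at h3
      linear_combination r₁ - ((l : F) + 1) * h3

end recurrence

end Jacobi

theorem natCast_add_one_add_ne_zero {F : Type*} [Field F] [CharZero F] {n : ℕ} (hn : 2 ≤ n)
    (i : ℕ) : (i : F) + 1 + 1 / (n : F) ≠ 0 := by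
  have h0 : (n : F) ≠ 0 := by exact_mod_cast (by omega : n ≠ 0)
  intro h
  field_simp at h
  have : n * (i + 1) + 1 = 0 := by exact_mod_cast h
  omega

theorem natCast_add_one_sub_ne_zero {F : Type*} [Field F] [CharZero F] {n : ℕ} (hn : 2 ≤ n)
    (i : ℕ) : (i : F) + 1 - 1 / (n : F) ≠ 0 := by
  have h0 : (n : F) ≠ 0 := by exact_mod_cast (by omega : n ≠ 0)
  intro h
  field_simp at h
  have h2 : (n : F) * (i + 1) = 1 := by linear_combination h
  have : n * (i + 1) = 1 := by exact_mod_cast h2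
  have := Nat.eq_one_of_mul_eq_one_right this
  omega

/-- The coefficients of `X_{n,r}` are those of `jacobiSum (1 / n) r`, up to the constant
`r! (1 + 1/n) ⋯ (r + 1/n)`. -/
theorem ordinaryHypergeometricCoefficient_eq {n : ℕ} (hn : 2 ≤ n) {r k : ℕ} (hk : k ≤ r) :
    ordinaryHypergeometricCoefficient
        (-(r : ℚ)) (-(r : ℚ) - 1 / (n : ℚ)) (1 - 1 / (n : ℚ)) k
      = (r.factorial : ℚ) * (∏ i ∈ range r, ((i : ℚ) + 1 + 1 / n)) *
        (jacobiWeight (-(1 / (n : ℚ))) k * jacobiWeight (1 / (n : ℚ)) (r - k)) := by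
  induction k with
  | zero =>
    have h1 : ∏ i ∈ range r, ((i : ℚ) + 1 + 1 / n) ≠ 0 :=
      prod_ne_zero_iff.2 fun i _ => natCast_add_one_add_ne_zero hn i
    have h2 : (r.factorial : ℚ) ≠ 0 := by exact_mod_cast r.factorial_ne_zero
    simp only [ordinaryHypergeometricCoefficient, jacobiWeight_zero, Nat.sub_zero]
    simp only [jacobiWeight]
    simp
    rw [← mul_inv_rev, mul_inv_cancel₀]
    simpa using mul_ne_zero h2 h1
  | succ k ih =>
    have ih := ih (by omega)
    obtain ⟨j, rfl⟩ : ∃ j, r = k + 1 + j := ⟨r - (k + 1), by omega⟩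
    have e1 : k + 1 + j - k = j + 1 := by omega
    have e2 : k + 1 + j - (k + 1) = j := by omega
    rw [e1] at ih
    rw [e2]
    have w1 := jacobiWeight_succ (a := (1 / n : ℚ)) (natCast_add_one_add_ne_zero hn) j
    have w2 := jacobiWeight_succ (a := (-(1 / n) : ℚ))
      (fun i => by simpa [sub_eq_add_neg] using natCast_add_one_sub_ne_zero (F := ℚ) hn i) k
    have n1 : ((k : ℚ) + 1) ≠ 0 := by exact_mod_cast Nat.succ_ne_zero k
    have n2 := natCast_add_one_sub_ne_zero (F := ℚ) hn k
    rw [← w1]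
    rw [← w2] at ih
    simp only [ordinaryHypergeometricCoefficient, ascPochhammer_succ_eval, Nat.factorial_succ]
      at ih ⊢
    push_cast at ih ⊢
    have n3 : (1 - 1 / (n : ℚ) + k) ≠ 0 := by rwa [add_comm, ← add_sub_assoc]
    rw [mul_inv, mul_inv]
    have n4 : ((k : ℚ) + 1 + -(1 / n)) ≠ 0 := by rwa [← sub_eq_add_neg]
    have n5 : (1 - 1 / (n : ℚ) + k)⁻¹ = ((k : ℚ) + 1 + -(1 / n))⁻¹ := by congr 1; ring
    rw [n5]
    apply mul_left_cancel₀ (mul_ne_zero n1 n4)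
    have i1 : ((k : ℚ) + 1) * ((k : ℚ) + 1)⁻¹ = 1 := mul_inv_cancel₀ n1
    have i2 : ((k : ℚ) + 1 + -(1 / n)) * ((k : ℚ) + 1 + -(1 / n))⁻¹ = 1 := mul_inv_cancel₀ n4
    have key := congrArg (fun t => ((j : ℚ) + 1) * (j + 1 + 1 / n) * t) ih
    refine Eq.trans ?_ (Eq.trans key ?_)
    · set P₁ := eval (-((k : ℚ) + 1 + j)) (ascPochhammer ℚ k)
      set P₂ := eval (-((k : ℚ) + 1 + j) - 1 / n) (ascPochhammer ℚ k)
      set P₃ := (eval (1 - 1 / (n : ℚ)) (ascPochhammer ℚ k))⁻¹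
      set f := (k.factorial : ℚ)⁻¹
      set y := ((k : ℚ) + 1)⁻¹
      set w := ((k : ℚ) + 1 + -(1 / n))⁻¹
      linear_combination ((j : ℚ) + 1) * (j + 1 + 1 / n) * f * P₁ * P₂ * P₃ *
        (((k : ℚ) + 1 + -(1 / n)) * w) * i1 + ((j : ℚ) + 1) * (j + 1 + 1 / n) * f * P₁ * P₂ * P₃ *
            i2
    · ring

/-! ### Upper bounds for Jacobi forms -/

/-- The bound on a circle `‖u‖ = ‖v‖ = ρ`. Since `‖u - v‖ ^ 2 = 4 ρ ^ 2 - ‖u + v‖ ^ 2`, the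
recurrence propagates a geometric bound with ratio `2 ρ + ‖u + v‖`. -/
theorem norm_jacobiForm_le_of_norm_eq {a : ℝ} (ha₀ : 0 < a) (ha₁ : a < 1) {u v : ℂ} {ρ : ℝ}
    (hu : ‖u‖ = ρ) (hv : ‖v‖ = ρ) (r : ℕ) :
    ‖jacobiForm (a : ℂ) r u v‖ ≤ (2 * ρ + ‖u + v‖) ^ r := by
  have h₁ : ∀ i : ℕ, (i : ℂ) + 1 + (a : ℂ) ≠ 0 := fun i => by
    have : (i : ℝ) + 1 + a ≠ 0 := by positivity
    exact_mod_cast this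
  have h₂ : ∀ i : ℕ, (i : ℂ) + 1 - (a : ℂ) ≠ 0 := fun i => by
    have : (i : ℝ) + 1 - a ≠ 0 := by
      have : (0 : ℝ) ≤ i := i.cast_nonneg
      linarith
    exact_mod_cast this
  have hρ : 0 ≤ ρ := hu ▸ norm_nonneg u
  have hw : 0 ≤ ‖u + v‖ := norm_nonneg _
  induction r using Nat.twoStepInduction with
  | zero => simp [jacobiForm_zero]
  | one =>
    rw [jacobiForm_one (by simpa using h₁ 0) (by simpa using h₂ 0), pow_one]
    have e1 : ‖(1 + a : ℂ)‖ = 1 + a := by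
      rw [show (1 + a : ℂ) = ((1 + a : ℝ) : ℂ) by push_cast; rfl, Complex.norm_real,
        Real.norm_of_nonneg (by linarith)]
    have e2 : ‖(1 - a : ℂ)‖ = 1 - a := by
      rw [show (1 - a : ℂ) = ((1 - a : ℝ) : ℂ) by push_cast; rfl, Complex.norm_real,
        Real.norm_of_nonneg (by linarith)]
    refine (norm_add_le _ _).trans ?_
    rw [norm_mul, norm_mul, e1, e2, hu, hv]
    linarith
  | more l ih₀ ih₁ =>
    have par : ‖u - v‖ ^ 2 = 4 * ρ ^ 2 - ‖u + v‖ ^ 2 := by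
      have := parallelogram_law_with_norm ℝ u v
      rw [hu, hv] at this
      nlinarith
    set w := ‖u + v‖ with hwdef
    have hw2 : w ≤ 2 * ρ := by
      refine (norm_add_le _ _).trans ?_
      rw [hu, hv]; linarith
    have hrec := congrArg norm (jacobiForm_recurrence h₁ h₂ l u v)
    have n1 : ‖((l : ℂ) + 1) * (l + 2)‖ = ((l : ℝ) + 1) * (l + 2) := by
      rw [show ((l : ℂ) + 1) * (l + 2) = (((l + 1) * (l + 2) : ℕ) : ℂ) by push_cast; rfl,
        Complex.norm_natCast]
      push_cast; rfl
    have n2 : ‖((l : ℂ) + 1) * (2 * l + 3)‖ = ((l : ℝ) + 1) * (2 * l + 3) := by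
      rw [show ((l : ℂ) + 1) * (2 * l + 3) = (((l + 1) * (2 * l + 3) : ℕ) : ℂ) by push_cast; rfl,
        Complex.norm_natCast]
      push_cast; rfl
    have hl : (0 : ℝ) ≤ l := l.cast_nonneg
    have n3 : ‖((l : ℂ) + 1) ^ 2 - (a : ℂ) ^ 2‖ ≤ ((l : ℝ) + 1) ^ 2 := by
      rw [show ((l : ℂ) + 1) ^ 2 - (a : ℂ) ^ 2 = ((((l : ℝ) + 1) ^ 2 - a ^ 2 : ℝ) : ℂ) by
        push_cast; rfl, Complex.norm_real, Real.norm_of_nonneg (by nlinarith)]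
      nlinarith
    rw [norm_mul, n1] at hrec
    have b1 : ((l : ℝ) + 1) * (l + 2) * ‖jacobiForm (a : ℂ) (l + 2) u v‖
        ≤ ((l : ℝ) + 1) * (2 * l + 3) * w * (2 * ρ + w) ^ (l + 1)
          + ((l : ℝ) + 1) ^ 2 * (4 * ρ ^ 2 - w ^ 2) * (2 * ρ + w) ^ l := by
      rw [hrec]
      refine (norm_sub_le _ _).trans ?_
      rw [norm_mul, norm_mul, n2, norm_mul, norm_mul, norm_pow, par]
      have : 0 ≤ 4 * ρ ^ 2 - w ^ 2 := par ▸ sq_nonneg _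
      gcongr
    have hM : 0 ≤ (2 * ρ + w) ^ l := by positivity
    have b2 : ((l : ℝ) + 1) * (2 * l + 3) * w * (2 * ρ + w) ^ (l + 1)
          + ((l : ℝ) + 1) ^ 2 * (4 * ρ ^ 2 - w ^ 2) * (2 * ρ + w) ^ l
        ≤ ((l : ℝ) + 1) * (l + 2) * (2 * ρ + w) ^ (l + 2) := by
      have : ((l : ℝ) + 1) * (l + 2) * (2 * ρ + w) ^ (l + 2)
        - (((l : ℝ) + 1) * (2 * l + 3) * w * (2 * ρ + w) ^ (l + 1)
          + ((l : ℝ) + 1) ^ 2 * (4 * ρ ^ 2 - w ^ 2) * (2 * ρ + w) ^ l)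
        = ((l : ℝ) + 1) * (2 * ρ + w) ^ l * ((2 * ρ + w) * (2 * ρ)) := by ring
      have h2 : 0 ≤ ((l : ℝ) + 1) * (2 * ρ + w) ^ l * ((2 * ρ + w) * (2 * ρ)) := by positivity
      linarith
    exact le_of_mul_le_mul_left (b1.trans b2) (by positivity)

theorem prod_sub_mul_factorial_le {a : ℝ} (ha₀ : 0 ≤ a) (ha₁ : a < 1) (k m : ℕ) :
    (∏ i ∈ range (k + m), ((i : ℝ) + 1 - a)) * k.factorial
      ≤ (k + m).factorial * ∏ i ∈ range k, ((i : ℝ) + 1 - a) := by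
  have hpos : ∀ i : ℕ, 0 < (i : ℝ) + 1 - a := fun i => by
    have : (0 : ℝ) ≤ i := i.cast_nonneg
    linarith
  induction m with
  | zero => simp [mul_comm]
  | succ m ih =>
    rw [← add_assoc, prod_range_succ, Nat.factorial_succ]
    push_cast
    have h0 : 0 ≤ (∏ i ∈ range (k + m), ((i : ℝ) + 1 - a)) * k.factorial :=
      mul_nonneg (prod_nonneg fun i _ => (hpos i).le) (Nat.cast_nonneg _)
    have h1 := hpos (k + m)
    push_cast at h1
    calc _ = (∏ i ∈ range (k + m), ((i : ℝ) + 1 - a)) * k.factorial * ((k : ℝ) + m + 1 - a) := by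
          ring
      _ ≤ (∏ i ∈ range (k + m), ((i : ℝ) + 1 - a)) * k.factorial * ((k : ℝ) + m + 1) := by
          gcongr; linarith
      _ ≤ ((k + m).factorial * ∏ i ∈ range k, ((i : ℝ) + 1 - a)) * ((k : ℝ) + m + 1) := by
          gcongr
      _ = _ := by ring

theorem prod_add_mul_factorial_le {a : ℝ} (ha₀ : 0 ≤ a) (ha₁ : a < 1) (j m : ℕ) :
    (∏ i ∈ range (j + m), ((i : ℝ) + 1 + a)) * j.factorial * (j + 1)
      ≤ (j + m).factorial * (∏ i ∈ range j, ((i : ℝ) + 1 + a)) * (j + 1 + a * m) := by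
  induction m with
  | zero => simp [mul_comm]
  | succ m ih =>
    rw [← add_assoc, prod_range_succ, Nat.factorial_succ]
    push_cast
    have hP : 0 ≤ ((j + m).factorial : ℝ) * ∏ i ∈ range j, ((i : ℝ) + 1 + a) :=
      mul_nonneg (Nat.cast_nonneg _) (prod_nonneg fun i _ => by positivity)
    calc _ = ((∏ i ∈ range (j + m), ((i : ℝ) + 1 + a)) * j.factorial * (j + 1))
            * ((j : ℝ) + m + 1 + a) := by ring
      _ ≤ ((j + m).factorial * (∏ i ∈ range j, ((i : ℝ) + 1 + a)) * (j + 1 + a * m))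
            * ((j : ℝ) + m + 1 + a) := by gcongr
      _ = (((j + m).factorial : ℝ) * ∏ i ∈ range j, ((i : ℝ) + 1 + a))
            * ((j + 1 + a * m) * ((j : ℝ) + m + 1 + a)) := by ring
      _ ≤ (((j + m).factorial : ℝ) * ∏ i ∈ range j, ((i : ℝ) + 1 + a))
            * (((j : ℝ) + m + 1) * (j + 1 + a * (m + 1))) := by
          refine mul_le_mul_of_nonneg_left ?_ hP
          have : 0 ≤ a * m * (1 - a) := mul_nonneg (by positivity) (by linarith)
          nlinarith
      _ = _ := by ring

/-- `C(r - a, j) C(r + a, r - j) ≤ C(r, j) ^ 2 + a C(r, j) C(r, j + 1)`, with `r = k + j`. -/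
theorem jacobiCoeff_le {a : ℝ} (ha₀ : 0 ≤ a) (ha₁ : a < 1) (k j : ℕ) :
    (∏ i ∈ range (k + j), ((i : ℝ) + 1 - a)) * (∏ i ∈ range (k + j), ((i : ℝ) + 1 + a)) *
        (jacobiWeight (-a) k * jacobiWeight a j)
      ≤ ((k + j).choose j : ℝ) ^ 2 + a * ((k + j).choose j * (k + j).choose (j + 1)) := by
  have hpos : ∀ i : ℕ, 0 < (i : ℝ) + 1 - a := fun i => by
    have : (0 : ℝ) ≤ i := i.cast_nonneg
    linarith
  have hG : 0 < ∏ i ∈ range k, ((i : ℝ) + 1 - a) := prod_pos fun i _ => hpos i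
  have hH : 0 < ∏ i ∈ range j, ((i : ℝ) + 1 + a) := prod_pos fun i _ => by positivity
  have hG' : 0 < ∏ i ∈ range (k + j), ((i : ℝ) + 1 - a) := prod_pos fun i _ => hpos i
  have hH' : 0 < ∏ i ∈ range (k + j), ((i : ℝ) + 1 + a) := prod_pos fun i _ => by positivity
  have b1 := prod_sub_mul_factorial_le ha₀ ha₁ k j
  have b2 := prod_add_mul_factorial_le ha₀ ha₁ j k
  rw [add_comm j k] at b2
  have c1 : ((k + j).choose j : ℝ) * (k.factorial * j.factorial) = (k + j).factorial := by
    rw [← mul_assoc]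
    exact_mod_cast Nat.add_choose_mul_factorial_mul_factorial k j
  have c2 : ((k + j).choose (j + 1) : ℝ) * (j + 1) = (k + j).choose j * k := by
    have := Nat.choose_succ_right_eq (k + j) j
    rw [Nat.add_sub_cancel] at this
    exact_mod_cast this
  have kf : (0 : ℝ) < k.factorial := by exact_mod_cast k.factorial_pos
  have jf : (0 : ℝ) < j.factorial := by exact_mod_cast j.factorial_pos
  have hw : jacobiWeight (-a) k * jacobiWeight a j
      = 1 / (k.factorial * (∏ i ∈ range k, ((i : ℝ) + 1 - a)) *
        (j.factorial * ∏ i ∈ range j, ((i : ℝ) + 1 + a))) := by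
    simp only [jacobiWeight, sub_eq_add_neg]
    rw [one_div, ← mul_inv]
  rw [hw, mul_one_div, div_le_iff₀ (by positivity)]
  have hj : (0 : ℝ) < j + 1 := by positivity
  refine le_of_mul_le_mul_left ?_ (show 0 < (k.factorial : ℝ) * (j.factorial * (j + 1)) by
    positivity)
  have b3 := mul_le_mul b1 b2 (by positivity) (by positivity)
  refine le_trans (le_of_eq ?_) (b3.trans (le_of_eq ?_))
  · ring
  · rw [← c1]
    linear_combination -((k + j).choose j : ℝ) * (k.factorial * j.factorial) ^ 2 *
      (∏ i ∈ range k, ((i : ℝ) + 1 - a)) * (∏ i ∈ range j, ((i : ℝ) + 1 + a)) * a * c2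

theorem sum_sq_add_two_mul_sum_mul_succ_le {α : ℕ → ℝ} (hα : ∀ i, 0 ≤ α i) (r : ℕ) :
    ∑ j ∈ range (r + 1), α j ^ 2 + 2 * ∑ j ∈ range r, α j * α (j + 1)
      ≤ (∑ j ∈ range (r + 1), α j) ^ 2 := by
  induction r with
  | zero => simp
  | succ r ih =>
    rw [sum_range_succ (fun j => α j ^ 2) (r + 1), sum_range_succ (fun j => α j * α (j + 1)) r,
      sum_range_succ α (r + 1)]
    have h1 : α r ≤ ∑ j ∈ range (r + 1), α j :=
      single_le_sum (f := α) (fun i _ => hα i) (by simp)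
    have h2 := mul_le_mul_of_nonneg_right h1 (hα (r + 1))
    nlinarith

/-- The bound at positive reals, by comparison with `(s + t) ^ (2 r)`, the square of
`∑ C(r, j) t ^ j s ^ (r - j)`. The condition `a s ≤ 6 t` is needed: the constant term in `t` is
`C(r + a, r) s ^ (2 r)`, and `C(r + a, r)` is unbounded. -/
theorem jacobiForm_sq_le {a s t : ℝ} (ha₀ : 0 ≤ a) (ha₁ : a < 1) (hs : 0 ≤ s) (ht : 0 < t)
    (hst : a * s ≤ 6 * t) (r : ℕ) :
    jacobiForm a r (s ^ 2) (t ^ 2) ≤ 3 * (s + t) ^ (2 * r) := by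
  set α : ℕ → ℝ := fun j => r.choose j * (t ^ j * s ^ (r - j)) with hα
  have hα0 : ∀ j, 0 ≤ α j := fun j => by positivity
  have hsum : ∑ j ∈ range (r + 1), α j = (s + t) ^ r := by
    rw [add_comm s t, add_pow]
    exact sum_congr rfl fun j _ => by simp only [hα]; ring
  have hterm : ∀ j ∈ range (r + 1),
      (∏ i ∈ range r, ((i : ℝ) + 1 - a)) * (∏ i ∈ range r, ((i : ℝ) + 1 + a)) *
        (jacobiWeight (-a) (r - j) * jacobiWeight a j * (s ^ 2) ^ (r - j) * (t ^ 2) ^ j)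
      ≤ α j ^ 2 + 6 * (α j * α (j + 1)) := by
    intro j hj
    obtain ⟨k, rfl⟩ : ∃ k, r = k + j := ⟨r - j, by have := mem_range.1 hj; omega⟩
    have hc := jacobiCoeff_le ha₀ ha₁ k j
    simp only [hα, Nat.add_sub_cancel]
    have hp : (0 : ℝ) ≤ (s ^ 2) ^ k * (t ^ 2) ^ j := by positivity
    refine le_trans (le_of_eq ?_) ((mul_le_mul_of_nonneg_right hc hp).trans ?_)
    · ring
    · rw [add_mul]
      refine add_le_add (le_of_eq (by ring)) ?_
      rcases k with _ | k
      · simp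
      · have e : k + 1 + j - (j + 1) = k := by omega
        rw [e]
        have hq : 0 ≤ ((k + 1 + j).choose j : ℝ) * (k + 1 + j).choose (j + 1) * s ^ (2 * k + 1)
          * t ^ (2 * j) := by positivity
        have := mul_le_mul_of_nonneg_left hst hq
        refine le_trans (le_of_eq ?_) (this.trans (le_of_eq ?_)) <;> ring
  have hform : jacobiForm a r (s ^ 2) (t ^ 2) = ∑ j ∈ range (r + 1),
      (∏ i ∈ range r, ((i : ℝ) + 1 - a)) * (∏ i ∈ range r, ((i : ℝ) + 1 + a)) *
        (jacobiWeight (-a) (r - j) * jacobiWeight a j * (s ^ 2) ^ (r - j) * (t ^ 2) ^ j) := by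
    rw [jacobiForm, jacobiSum, mul_sum, ← Finset.Nat.sum_antidiagonal_swap,
      Finset.Nat.sum_antidiagonal_eq_sum_range_succ_mk]
    rfl
  have hlast : α (r + 1) = 0 := by simp [hα]
  have hoff : ∑ j ∈ range (r + 1), α j * α (j + 1) = ∑ j ∈ range r, α j * α (j + 1) := by
    rw [sum_range_succ, hlast, mul_zero, add_zero]
  calc jacobiForm a r (s ^ 2) (t ^ 2)
      ≤ ∑ j ∈ range (r + 1), (α j ^ 2 + 6 * (α j * α (j + 1))) := hform ▸ sum_le_sum hterm
    _ = ∑ j ∈ range (r + 1), α j ^ 2 + 6 * ∑ j ∈ range r, α j * α (j + 1) := by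
        rw [sum_add_distrib, ← mul_sum, hoff]
    _ ≤ 3 * (∑ j ∈ range (r + 1), α j) ^ 2 := by
        have h1 := sum_sq_add_two_mul_sum_mul_succ_le hα0 r
        have h2 : 0 ≤ ∑ j ∈ range (r + 1), α j ^ 2 := sum_nonneg fun j _ => sq_nonneg _
        linarith
    _ = 3 * (s + t) ^ (2 * r) := by rw [hsum, ← pow_mul, mul_comm r 2]

theorem jacobiForm_nonneg {a s t : ℝ} (ha₀ : 0 ≤ a) (ha₁ : a < 1) (hs : 0 ≤ s) (ht : 0 ≤ t)
    (r : ℕ) : 0 ≤ jacobiForm a r s t := by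
  have hpos : ∀ i : ℕ, 0 ≤ (i : ℝ) + 1 - a := fun i => by
    have : (0 : ℝ) ≤ i := i.cast_nonneg
    linarith
  have hw : ∀ k, 0 ≤ jacobiWeight (-a) k := fun k => by
    rw [jacobiWeight]
    exact inv_nonneg.2 (mul_nonneg (Nat.cast_nonneg _)
      (prod_nonneg fun i _ => by rw [← sub_eq_add_neg]; exact hpos i))
  have hw' : ∀ k, 0 ≤ jacobiWeight a k := fun k => by
    rw [jacobiWeight]
    positivity
  exact mul_nonneg (mul_nonneg (prod_nonneg fun i _ => hpos i)
    (prod_nonneg fun i _ => by positivity)) (sum_nonneg fun x _ => mul_nonneg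
      (mul_nonneg (mul_nonneg (hw _) (hw' _)) (by positivity)) (by positivity))

/-! ### The Padé remainder as an integral -/

/-- The partial fraction expansion of `r! / (x (x + 1) ⋯ (x + r))`. -/
theorem sum_neg_one_pow_mul_choose_div {F : Type*} [Field F] (r : ℕ) (x : F)
    (hx : ∀ i ≤ r, x + i ≠ 0) :
    ∑ i ∈ range (r + 1), (-1) ^ i * (r.choose i : F) / (x + i)
      = r.factorial / ∏ i ∈ range (r + 1), (x + i) := by
  induction r generalizing x with
  | zero => simp
  | succ r ih =>
    have ih₁ := ih x fun i hi => hx i (by omega)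
    have ih₂ := ih (x + 1) fun i hi => by
      have := hx (i + 1) (by omega)
      push_cast at this
      rwa [add_assoc, add_comm (1 : F)]
    have step : ∑ i ∈ range (r + 1 + 1), (-1) ^ i * ((r + 1).choose i : F) / (x + i)
        = ∑ i ∈ range (r + 1), (-1) ^ i * (r.choose i : F) / (x + i)
          - ∑ i ∈ range (r + 1), (-1) ^ i * (r.choose i : F) / (x + 1 + i) := by
      rw [sum_range_succ' _ (r + 1)]
      have h1 : ∀ i ∈ range (r + 1), (-1) ^ (i + 1) * ((r + 1).choose (i + 1) : F)
          / (x + (i + 1 : ℕ))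
          = (-1) ^ (i + 1) * (r.choose (i + 1) : F) / (x + (i + 1 : ℕ))
            - (-1) ^ i * (r.choose i : F) / (x + 1 + i) := by
        intro i _
        rw [Nat.choose_succ_succ, show x + ((i + 1 : ℕ) : F) = x + 1 + i by push_cast; ring]
        push_cast
        ring
      rw [sum_congr rfl h1, sum_sub_distrib]
      rw [sum_range_succ' (fun i => (-1) ^ i * (r.choose i : F) / (x + i)) r]
      rw [sum_range_succ (fun i => (-1) ^ (i + 1) * (r.choose (i + 1) : F) / (x + (i + 1 : ℕ))) r]
      simp
      ring
    rw [step, ih₁, ih₂]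
    have e1 : ∏ i ∈ range (r + 1 + 1), (x + (i : F))
        = (∏ i ∈ range (r + 1), (x + (i : F))) * (x + (r + 1 : ℕ)) := prod_range_succ _ _
    have e2 : ∏ i ∈ range (r + 1 + 1), (x + (i : F))
        = (∏ i ∈ range (r + 1), (x + 1 + (i : F))) * x := by
      rw [prod_range_succ']
      simp only [Nat.cast_add, Nat.cast_one, Nat.cast_zero, add_zero]
      congr 1
      exact prod_congr rfl fun i _ => by ring
    have n0 : ∏ i ∈ range (r + 1 + 1), (x + (i : F)) ≠ 0 :=
      prod_ne_zero_iff.2 fun i hi => hx i (by have := mem_range.1 hi; omega)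
    have n1 : ∏ i ∈ range (r + 1), (x + (i : F)) ≠ 0 := fun h => n0 (by rw [e1, h, zero_mul])
    have n2 : ∏ i ∈ range (r + 1), (x + 1 + (i : F)) ≠ 0 := fun h => n0 (by rw [e2, h, zero_mul])
    rw [div_sub_div _ _ n1 n2, div_eq_div_iff (mul_ne_zero n1 n2) n0, Nat.factorial_succ]
    generalize ∏ i ∈ range (r + 1), (x + (i : F)) = A at *
    generalize ∏ i ∈ range (r + 1), (x + 1 + (i : F)) = B at *
    generalize ∏ i ∈ range (r + 1 + 1), (x + (i : F)) = D at *
    push_cast at e1 ⊢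
    have e3 : A * (x + (r + 1)) = B * x := e1.symm.trans e2
    rw [e2]
    linear_combination -(r.factorial : F) * B * e3

theorem choose_mul_factorial_div_prod {F : Type*} [Field F] [CharZero F] {a : F}
    (j m : ℕ) :
    (-1) ^ j * ((j + m).choose j : F) *
        ((j + m).factorial / ∏ l ∈ range (j + m + 1), (a - j + l))
      = ((j + m).factorial : F) ^ 2 / a * (jacobiWeight (-a) j * jacobiWeight a m) := by
  have hprod : ∏ l ∈ range (j + m + 1), (a - j + (l : F))
      = (-1) ^ j * (∏ i ∈ range j, ((i : F) + 1 + -a)) * (a * ∏ i ∈ range m, ((i : F) + 1 + a)) := by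
    rw [add_assoc, prod_range_add]
    congr 1
    · rw [← prod_range_reflect, ← card_range j, ← prod_const, card_range, ← prod_mul_distrib]
      refine prod_congr rfl fun i hi => ?_
      have : i < j := mem_range.1 hi
      rw [show j - 1 - i = j - (i + 1) by omega, Nat.cast_sub (by omega)]
      push_cast
      ring
    · rw [prod_range_succ', mul_comm]
      congr 1
      · push_cast; ring
      · exact prod_congr rfl fun i _ => by push_cast; ring
  have hc : ((j + m).choose j : F) * (j.factorial * m.factorial) = (j + m).factorial := by
    rw [← mul_assoc, Nat.choose_symm_add]
    exact_mod_cast Nat.add_choose_mul_factorial_mul_factorial j m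
  have hj : (j.factorial : F) ≠ 0 := by exact_mod_cast j.factorial_ne_zero
  have hm : (m.factorial : F) ≠ 0 := by exact_mod_cast m.factorial_ne_zero
  have hc' : ((j + m).choose j : F) = (j + m).factorial * (j.factorial : F)⁻¹ * (m.factorial : F)⁻¹ := by
    field_simp
    linear_combination hc
  have hs : ((-1 : F) ^ j)⁻¹ = (-1) ^ j := by
    rw [← inv_pow, inv_neg_one]
  rw [hprod, hc']
  simp only [jacobiWeight, div_eq_mul_inv, mul_inv, hs]
  have h1 : ((-1 : F) ^ j) * (-1) ^ j = 1 := by rw [← mul_pow]; simp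
  linear_combination ((j + m).factorial : F) ^ 2 * (j.factorial : F)⁻¹ * (m.factorial : F)⁻¹ *
    (∏ i ∈ range j, ((i : F) + 1 + -a))⁻¹ * a⁻¹ * (∏ i ∈ range m, ((i : F) + 1 + a))⁻¹ * h1

theorem intervalIntegral_mul_exp (L : ℂ) {ν : ℂ} (hν : ν ≠ 0) :
    ∫ s in (0 : ℝ)..1, L * Complex.exp (s * (L * ν)) = (Complex.exp (L * ν) - 1) / ν := by
  rcases eq_or_ne L 0 with rfl | hL
  · simp
  · rw [intervalIntegral.integral_const_mul]
    simp_rw [mul_comm (Complex.ofReal _)]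
    rw [integral_exp_mul_complex (mul_ne_zero hL hν)]
    simp
    field_simp

/-- The Padé remainder as an integral. With `z = exp L`, the left side is a multiple of
`z ^ a jacobiSum a r 1 z - jacobiSum a r z 1`; the right side is
`∫_1^z (1 - t) ^ r (1 - z / t) ^ r t ^ (a - 1) dt` along `t = exp (s L)`. -/
theorem factorial_sq_div_mul_jacobiSum_sub {a : ℂ} (ha : ∀ m : ℤ, a + m ≠ 0) (L : ℂ) (r : ℕ) :
    (r.factorial : ℂ) ^ 2 / a * (Complex.exp (L * a) * jacobiSum a r 1 (Complex.exp L)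
        - jacobiSum a r (Complex.exp L) 1)
      = ∫ s in (0 : ℝ)..1, L * ((1 - Complex.exp (s * L)) * (1 - Complex.exp (L - s * L))) ^ r
          * Complex.exp (s * (L * a)) := by
  set z := Complex.exp L with hz
  have hexp : ∀ s : ℝ, L * ((1 - Complex.exp (s * L)) * (1 - Complex.exp (L - s * L))) ^ r
          * Complex.exp (s * (L * a))
      = ∑ i ∈ range (r + 1), ∑ j ∈ range (r + 1),
          ((-1) ^ i * (r.choose i : ℂ)) * ((-1) ^ j * (r.choose j : ℂ)) * z ^ j *
            (L * Complex.exp (s * (L * (a + ((i : ℤ) - (j : ℤ) : ℤ))))) := by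
    intro s
    have hpow : ∀ x : ℂ, (1 - x) ^ r = ∑ i ∈ range (r + 1), (-1) ^ i * (r.choose i : ℂ) * x ^ i := by
      intro x
      rw [sub_eq_add_neg, add_comm, add_pow]
      exact sum_congr rfl fun i _ => by rw [neg_pow]; ring
    rw [mul_pow, hpow, hpow, sum_mul_sum, mul_sum, sum_mul]
    refine sum_congr rfl fun i _ => ?_
    rw [mul_sum, sum_mul]
    refine sum_congr rfl fun j _ => ?_
    have : Complex.exp (s * L) ^ i * Complex.exp (L - s * L) ^ j * Complex.exp (s * (L * a))
        = z ^ j * Complex.exp (s * (L * (a + ((i : ℤ) - (j : ℤ) : ℤ)))) := by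
      rw [hz, ← Complex.exp_nat_mul, ← Complex.exp_nat_mul, ← Complex.exp_nat_mul,
        ← Complex.exp_add, ← Complex.exp_add, ← Complex.exp_add]
      congr 1
      push_cast
      ring
    linear_combination ((-1) ^ i * (r.choose i : ℂ)) * ((-1) ^ j * (r.choose j : ℂ)) * L * this
  simp_rw [hexp]
  have hint : ∀ ν c : ℂ, IntervalIntegrable (fun s : ℝ => c * (L * Complex.exp (s * (L * ν))))
      MeasureTheory.volume 0 1 := fun ν c => by
    apply Continuous.intervalIntegrable
    fun_prop
  rw [intervalIntegral.integral_finsetSum fun i _ => by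
    apply Continuous.intervalIntegrable
    fun_prop]
  have hterm : ∀ i ∈ range (r + 1), ∀ j ∈ range (r + 1),
      ∫ s in (0 : ℝ)..1, ((-1) ^ i * (r.choose i : ℂ)) * ((-1) ^ j * (r.choose j : ℂ)) * z ^ j *
            (L * Complex.exp (s * (L * (a + ((i : ℤ) - (j : ℤ) : ℤ)))))
        = Complex.exp (L * a) * (((-1) ^ i * (r.choose i : ℂ) * z ^ i) *
            ((-1) ^ j * (r.choose j : ℂ) / (a + (i - j))))
          - ((-1) ^ j * (r.choose j : ℂ) * z ^ j) *
            ((-1) ^ i * (r.choose i : ℂ) / (a - j + i)) := by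
    intro i _ j _
    have hν := ha ((i : ℤ) - j)
    rw [intervalIntegral.integral_const_mul, intervalIntegral_mul_exp L hν]
    have h1 : Complex.exp (L * (a + ((i : ℤ) - (j : ℤ) : ℤ))) * z ^ j
        = Complex.exp (L * a) * z ^ i := by
      rw [hz, ← Complex.exp_nat_mul, ← Complex.exp_nat_mul, ← Complex.exp_add, ← Complex.exp_add]
      congr 1
      push_cast
      ring
    have h2 : (a - j + i : ℂ) = a + ((i : ℤ) - (j : ℤ) : ℤ) := by push_cast; ring
    have h3 : (a + (i - j) : ℂ) = a + ((i : ℤ) - (j : ℤ) : ℤ) := by push_cast; ring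
    rw [h2, h3]
    linear_combination ((-1) ^ i * (r.choose i : ℂ)) * ((-1) ^ j * (r.choose j : ℂ))
      / (a + ((i : ℤ) - (j : ℤ) : ℤ)) * h1
  rw [sum_congr rfl fun i hi => by
    rw [intervalIntegral.integral_finsetSum fun j _ => hint _ _, sum_congr rfl (hterm i hi)]]
  simp only [sum_sub_distrib, ← mul_sum]
  have hfirst : ∀ i ∈ range (r + 1), ((-1) ^ i * (r.choose i : ℂ) * z ^ i) *
      ∑ j ∈ range (r + 1), (-1) ^ j * (r.choose j : ℂ) / (a + (i - j))
      = (r.factorial : ℂ) ^ 2 / a *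
        (jacobiWeight (-a) (r - i) * jacobiWeight a i * 1 ^ (r - i) * z ^ i) := by
    intro i hi
    obtain ⟨m, rfl⟩ : ∃ m, r = m + i := ⟨r - i, by have := mem_range.1 hi; omega⟩
    rw [Nat.add_sub_cancel]
    have hrefl : ∑ j ∈ range (m + i + 1), (-1) ^ j * ((m + i).choose j : ℂ) / (a + (i - j))
        = (-1) ^ (m + i) * ∑ j ∈ range (m + i + 1), (-1) ^ j * ((m + i).choose j : ℂ)
            / (a - m + j) := by
      rw [← sum_range_reflect, mul_sum]
      refine sum_congr rfl fun j hj => ?_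
      have hj' : j ≤ m + i := by have := mem_range.1 hj; omega
      rw [show m + i + 1 - 1 - j = m + i - j by omega, Nat.choose_symm hj', Nat.cast_sub hj',
        show ((-1 : ℂ)) ^ (m + i - j) = (-1) ^ (m + i) * (-1) ^ j by
          obtain ⟨t, ht⟩ := Nat.exists_eq_add_of_le hj'
          rw [ht, Nat.add_sub_cancel_left, pow_add, mul_comm ((-1 : ℂ) ^ j), mul_assoc, ← mul_pow]
          simp]
      push_cast
      rw [show a + ((i : ℂ) - (m + i - j)) = a - m + j by ring]
      ring
    rw [hrefl, sum_neg_one_pow_mul_choose_div _ _ fun l _ => by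
      have := ha ((l : ℤ) - m)
      push_cast at this
      rwa [sub_add_eq_add_sub, add_sub_assoc]]
    have key := choose_mul_factorial_div_prod (a := a) m i
    have hs : ((-1 : ℂ)) ^ i * (-1) ^ (m + i) = (-1) ^ m := by
      rw [pow_add, mul_comm, mul_assoc, ← mul_pow]; simp
    rw [Nat.choose_symm_add] at key
    linear_combination z ^ i * key + ((m + i).choose i : ℂ) * z ^ i * ((m + i).factorial /
      ∏ l ∈ range (m + i + 1), (a - m + (l : ℂ))) * hs
  have hsecond : ∀ j ∈ range (r + 1), ((-1) ^ j * (r.choose j : ℂ) * z ^ j) *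
      ∑ i ∈ range (r + 1), (-1) ^ i * (r.choose i : ℂ) / (a - j + i)
      = (r.factorial : ℂ) ^ 2 / a *
        (jacobiWeight (-a) j * jacobiWeight a (r - j) * z ^ j * 1 ^ (r - j)) := by
    intro j hj
    obtain ⟨m, rfl⟩ : ∃ m, r = j + m := ⟨r - j, by have := mem_range.1 hj; omega⟩
    rw [Nat.add_sub_cancel_left, sum_neg_one_pow_mul_choose_div _ _ fun l _ => by
      have := ha ((l : ℤ) - j)
      push_cast at this
      rwa [sub_add_eq_add_sub, add_sub_assoc]]
    have key := choose_mul_factorial_div_prod (a := a) j m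
    linear_combination z ^ j * key
  rw [sum_congr rfl hfirst]
  have hswap : ∑ i ∈ range (r + 1), ∑ j ∈ range (r + 1), ((-1) ^ j * (r.choose j : ℂ) * z ^ j) *
            ((-1) ^ i * (r.choose i : ℂ) / (a - j + i))
      = ∑ j ∈ range (r + 1), (r.factorial : ℂ) ^ 2 / a *
        (jacobiWeight (-a) j * jacobiWeight a (r - j) * z ^ j * 1 ^ (r - j)) := by
    rw [sum_comm]
    refine sum_congr rfl fun j hj => ?_
    rw [← mul_sum, hsecond j hj]
  rw [hswap, ← mul_sum, ← mul_sum]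
  have e1 : jacobiSum a r 1 z = ∑ i ∈ range (r + 1),
      jacobiWeight (-a) (r - i) * jacobiWeight a i * 1 ^ (r - i) * z ^ i := by
    rw [jacobiSum, ← Finset.Nat.sum_antidiagonal_swap,
      Finset.Nat.sum_antidiagonal_eq_sum_range_succ_mk]
    rfl
  have e2 : jacobiSum a r z 1 = ∑ j ∈ range (r + 1),
      jacobiWeight (-a) j * jacobiWeight a (r - j) * z ^ j * 1 ^ (r - j) := by
    rw [jacobiSum, Finset.Nat.sum_antidiagonal_eq_sum_range_succ_mk]
  rw [e1, e2]
  ring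

/-! ### Size of the Padé remainder -/

theorem ofReal_add_intCast_ne_zero {a : ℝ} (ha₀ : 0 < a) (ha₁ : a < 1) (m : ℤ) :
    (a : ℂ) + m ≠ 0 := by
  have : a + m ≠ 0 := by
    intro h
    have h1 : (m : ℝ) < 0 := by linarith
    have h2 : (-1 : ℝ) < m := by linarith
    have h3 : m < 0 := by exact_mod_cast h1
    have h4 : -1 < m := by exact_mod_cast h2
    omega
  exact_mod_cast this

/-- The integrand of the Padé remainder on the arc from `1` to `exp (I φ)`; the maximum is at the
midpoint `s = 1 / 2`. -/
theorem norm_integrand_exp_le {φ : ℝ} (hφ : |φ| ≤ Real.pi) {s : ℝ} (hs₀ : 0 ≤ s) (hs₁ : s ≤ 1) :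
    ‖(1 - Complex.exp (s * (Complex.I * φ))) *
        (1 - Complex.exp (Complex.I * φ - s * (Complex.I * φ)))‖
      ≤ 2 - 2 * Real.cos (φ / 2) := by
  have h1 : Complex.exp (s * (Complex.I * φ)) = Complex.exp (Complex.I * ((s * φ : ℝ) : ℂ)) := by
    congr 1; push_cast; ring
  have h2 : Complex.exp (Complex.I * φ - s * (Complex.I * φ))
      = Complex.exp (Complex.I * (((1 - s) * φ : ℝ) : ℂ)) := by
    congr 1; push_cast; ring
  rw [norm_mul, norm_sub_rev, h1, Complex.norm_exp_I_mul_ofReal_sub_one, norm_sub_rev, h2,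
    Complex.norm_exp_I_mul_ofReal_sub_one, ← norm_mul, Real.norm_eq_abs]
  have h3 : 2 * Real.sin (s * φ / 2) * (2 * Real.sin ((1 - s) * φ / 2))
      = 2 * (Real.cos ((2 * s - 1) * φ / 2) - Real.cos (φ / 2)) := by
    have e1 : (2 * s - 1) * φ / 2 = s * φ / 2 - (1 - s) * φ / 2 := by ring
    have e2 : φ / 2 = s * φ / 2 + (1 - s) * φ / 2 := by ring
    rw [e1, Real.cos_sub]
    conv_rhs => rw [e2, Real.cos_add]
    ring
  have h4 : Real.cos (φ / 2) ≤ Real.cos ((2 * s - 1) * φ / 2) := by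
    rw [← Real.cos_abs (φ / 2), ← Real.cos_abs ((2 * s - 1) * φ / 2)]
    have e3 : |φ / 2| = |φ| / 2 := by rw [abs_div, abs_two]
    have e4 : |(2 * s - 1) * φ / 2| = |2 * s - 1| * (|φ| / 2) := by
      rw [mul_div_assoc, abs_mul, e3]
    have e5 : |2 * s - 1| ≤ 1 := abs_le.2 ⟨by linarith, by linarith⟩
    apply Real.cos_le_cos_of_nonneg_of_le_pi (abs_nonneg _)
    · rw [e3]; linarith [Real.pi_pos]
    · rw [e3, e4]
      exact mul_le_of_le_one_left (by positivity) e5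
  rw [h3, abs_of_nonneg (by linarith)]
  linarith [Real.cos_le_one ((2 * s - 1) * φ / 2)]

theorem norm_one_add_exp {φ : ℝ} (hφ : |φ| ≤ Real.pi) :
    ‖1 + Complex.exp (Complex.I * φ)‖ = 2 * Real.cos (φ / 2) := by
  have h : 1 + Complex.exp (Complex.I * φ)
      = Complex.exp (((φ / 2 : ℝ) : ℂ) * Complex.I) * ((2 * Real.cos (φ / 2) : ℝ) : ℂ) := by
    push_cast
    rw [Complex.two_cos, mul_add, ← Complex.exp_add, ← Complex.exp_add]
    rw [show (φ : ℂ) / 2 * Complex.I + -((φ : ℂ) / 2) * Complex.I = 0 by ring, Complex.exp_zero,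
      add_comm]
    congr 2
    ring
  have hc : 0 ≤ Real.cos (φ / 2) :=
    Real.cos_nonneg_of_mem_Icc ⟨by linarith [(abs_le.1 hφ).1], by linarith [(abs_le.1 hφ).2]⟩
  rw [h, norm_mul, Complex.norm_exp_ofReal_mul_I, one_mul, Complex.norm_real,
    Real.norm_of_nonneg (by positivity)]

/-- The Padé remainder on the unit circle. The factor `2` comes from comparing an arc with its
chord. -/
theorem norm_remainder_le_of_norm_eq_one {a : ℝ} (ha₀ : 0 < a) (ha₁ : a < 1) {z : ℂ}
    (hz : ‖z‖ = 1) (r : ℕ) :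
    ‖(r.factorial : ℂ) ^ 2 * (z ^ (a : ℂ) * jacobiSum (a : ℂ) r 1 z - jacobiSum (a : ℂ) r z 1)‖
      ≤ 2 * ‖1 - z ^ (a : ℂ)‖ * (2 - ‖1 + z‖) ^ r := by
  have hz0 : z ≠ 0 := by rintro rfl; simp at hz
  set φ := Complex.arg z
  have hφ : |φ| ≤ Real.pi := Complex.abs_arg_le_pi z
  have hlog : Complex.log z = Complex.I * φ := by
    rw [Complex.log, hz]; simp [φ, mul_comm]
  have hexp : Complex.exp (Complex.I * φ) = z := by rw [← hlog, Complex.exp_log hz0]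
  have hω : z ^ (a : ℂ) = Complex.exp (Complex.I * φ * a) := by
    rw [Complex.cpow_def_of_ne_zero hz0, hlog]
  have hid := factorial_sq_div_mul_jacobiSum_sub (ofReal_add_intCast_ne_zero ha₀ ha₁)
    (Complex.I * φ) r
  rw [← hω, hexp] at hid
  set m := 2 - ‖1 + z‖ with hm
  have hm' : m = 2 - 2 * Real.cos (φ / 2) := by rw [hm, ← hexp, norm_one_add_exp hφ]
  have hb : ‖∫ s in (0 : ℝ)..1, Complex.I * φ * ((1 - Complex.exp (s * (Complex.I * φ))) *
      (1 - Complex.exp (Complex.I * φ - s * (Complex.I * φ)))) ^ r *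
        Complex.exp (s * (Complex.I * φ * a))‖ ≤ |φ| * m ^ r * |1 - 0| := by
    refine intervalIntegral.norm_integral_le_of_norm_le_const fun s hs => ?_
    rw [Set.uIoc_of_le zero_le_one] at hs
    have e : Complex.exp (s * (Complex.I * φ * a)) = Complex.exp (((s * φ * a : ℝ) : ℂ) * Complex.I) := by
      congr 1; push_cast; ring
    rw [norm_mul, norm_mul, e, Complex.norm_exp_ofReal_mul_I, mul_one, norm_mul, Complex.norm_I,
      one_mul, Complex.norm_real, Real.norm_eq_abs, norm_pow, hm']
    have := norm_integrand_exp_le hφ hs.1.le hs.2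
    gcongr
  rw [← hid] at hb
  have hdiff : a * |φ| ≤ 2 * ‖1 - z ^ (a : ℂ)‖ := by
    have e1 : z ^ (a : ℂ) = Complex.exp (Complex.I * ((φ * a : ℝ) : ℂ)) := by
      rw [hω]; congr 1; push_cast; ring
    rw [e1, norm_sub_rev, Complex.norm_exp_I_mul_ofReal_sub_one, Real.norm_eq_abs, abs_mul, abs_two]
    have e2 : |φ * a / 2| = |φ| * a / 2 := by
      rw [abs_div, abs_mul, abs_of_pos ha₀, abs_two]
    have e3 : |φ| * a ≤ Real.pi := by
      calc |φ| * a ≤ |φ| * 1 := by gcongr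
        _ ≤ Real.pi := by rwa [mul_one]
    have e4 := Real.mul_abs_le_abs_sin (x := φ * a / 2) (by rw [e2]; linarith)
    rw [e2] at e4
    have e5 : (1 : ℝ) / 2 ≤ 2 / Real.pi := by
      rw [div_le_div_iff₀ two_pos Real.pi_pos]; linarith [Real.pi_le_four]
    have e6 : 1 / 2 * (|φ| * a / 2) ≤ 2 / Real.pi * (|φ| * a / 2) := by gcongr
    linarith
  have hm0 : 0 ≤ m := by rw [hm']; linarith [Real.cos_le_one (φ / 2)]
  have haC : (a : ℂ) ≠ 0 := by exact_mod_cast ha₀.ne'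
  have hfin : (r.factorial : ℂ) ^ 2 * (z ^ (a : ℂ) * jacobiSum (a : ℂ) r 1 z
        - jacobiSum (a : ℂ) r z 1) = a * ((r.factorial : ℂ) ^ 2 / a * (z ^ (a : ℂ) *
        jacobiSum (a : ℂ) r 1 z - jacobiSum (a : ℂ) r z 1)) := by
    field_simp
  rw [hfin, norm_mul, Complex.norm_real, Real.norm_of_nonneg ha₀.le]
  calc _ ≤ a * (|φ| * m ^ r * |1 - 0|) := by gcongr
    _ = a * |φ| * m ^ r := by simp; ring
    _ ≤ _ := by gcongr

/-- The Padé remainder on `(0, 1)`, where the integral of the envelope is exactly `‖1 - t ^ a‖ / a`.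
-/
theorem norm_remainder_le_of_real {a : ℝ} (ha₀ : 0 < a) (ha₁ : a < 1) {t : ℝ}
    (ht₀ : 0 < t) (ht₁ : t < 1) (r : ℕ) :
    ‖(r.factorial : ℂ) ^ 2 * ((t : ℂ) ^ (a : ℂ) * jacobiSum (a : ℂ) r 1 t
        - jacobiSum (a : ℂ) r t 1)‖
      ≤ ‖1 - (t : ℂ) ^ (a : ℂ)‖ * ((1 - √t) ^ 2) ^ r := by
  have hz0 : (t : ℂ) ≠ 0 := by exact_mod_cast ht₀.ne'
  set L := Real.log t
  have hL : L < 0 := Real.log_neg ht₀ ht₁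
  have hlog : Complex.log t = L := (Complex.ofReal_log ht₀.le).symm
  have hexp : Complex.exp L = t := by rw [← hlog, Complex.exp_log hz0]
  have hexpR : Real.exp L = t := Real.exp_log ht₀
  have hω : (t : ℂ) ^ (a : ℂ) = Complex.exp (L * a) := by
    rw [Complex.cpow_def_of_ne_zero hz0, hlog]
  have hid := factorial_sq_div_mul_jacobiSum_sub (ofReal_add_intCast_ne_zero ha₀ ha₁) (L : ℂ) r
  rw [← hω, hexp] at hid
  set m := (1 - √t) ^ 2 with hm
  have hm0 : 0 ≤ m := sq_nonneg _
  have hint : ∫ s in (0 : ℝ)..1, -L * m ^ r * Real.exp (s * (L * a))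
      = m ^ r * (1 - Real.exp (L * a)) / a := by
    have h1 := intervalIntegral_mul_exp (L : ℂ) (ν := (a : ℂ)) (by exact_mod_cast ha₀.ne')
    have h2 : ∫ s in (0 : ℝ)..1, L * Real.exp (s * (L * a)) = (Real.exp (L * a) - 1) / a := by
      have : ((∫ s in (0 : ℝ)..1, L * Real.exp (s * (L * a)) : ℝ) : ℂ)
          = ((Real.exp (L * a) - 1) / a : ℝ) := by
        rw [← intervalIntegral.integral_ofReal]
        push_cast
        exact h1
      exact_mod_cast this
    have h3 : ∀ s : ℝ, -L * m ^ r * Real.exp (s * (L * a))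
        = -m ^ r * (L * Real.exp (s * (L * a))) := fun s => by ring
    simp_rw [h3]
    rw [intervalIntegral.integral_const_mul, h2]
    ring
  have hb : ‖∫ s in (0 : ℝ)..1, (L : ℂ) * ((1 - Complex.exp (s * (L : ℂ))) *
      (1 - Complex.exp ((L : ℂ) - s * L))) ^ r * Complex.exp (s * ((L : ℂ) * a))‖
      ≤ ∫ s in (0 : ℝ)..1, -L * m ^ r * Real.exp (s * (L * a)) := by
    refine intervalIntegral.norm_integral_le_of_norm_le zero_le_one ?_ ?_
    · refine Filter.Eventually.of_forall fun s hs => ?_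
      have e : (L : ℂ) * ((1 - Complex.exp (s * (L : ℂ))) *
          (1 - Complex.exp ((L : ℂ) - s * L))) ^ r * Complex.exp (s * ((L : ℂ) * a))
          = ((L * ((1 - Real.exp (s * L)) * (1 - Real.exp (L - s * L))) ^ r
            * Real.exp (s * (L * a)) : ℝ) : ℂ) := by push_cast; rfl
      rw [e, Complex.norm_real, norm_mul, norm_mul, Real.norm_eq_abs, abs_of_neg hL,
        Real.norm_of_nonneg (Real.exp_pos _).le, norm_pow]
      have hx : Real.exp (s * L) ≤ 1 := Real.exp_le_one_iff.2 (by nlinarith [hs.1])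
      have hy : Real.exp (L - s * L) ≤ 1 := Real.exp_le_one_iff.2 (by nlinarith [hs.2])
      have hxy : Real.exp (s * L) * Real.exp (L - s * L) = √t ^ 2 := by
        rw [← Real.exp_add, Real.sq_sqrt ht₀.le, ← hexpR]; congr 1; ring
      have hle : ‖(1 - Real.exp (s * L)) * (1 - Real.exp (L - s * L))‖ ≤ m := by
        rw [Real.norm_of_nonneg (mul_nonneg (by linarith) (by linarith)), hm]
        have hsum : 2 * √t ≤ Real.exp (s * L) + Real.exp (L - s * L) := by
          refine abs_le_of_sq_le_sq' ?_ (by positivity) |>.2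
          nlinarith [sq_nonneg (Real.exp (s * L) - Real.exp (L - s * L))]
        nlinarith
      have : 0 ≤ -L := by linarith
      gcongr
    · apply Continuous.intervalIntegrable
      fun_prop
  rw [← hid, hint] at hb
  have haC : (a : ℂ) ≠ 0 := by exact_mod_cast ha₀.ne'
  have hfin : (r.factorial : ℂ) ^ 2 * ((t : ℂ) ^ (a : ℂ) * jacobiSum (a : ℂ) r 1 t
        - jacobiSum (a : ℂ) r t 1) = a * ((r.factorial : ℂ) ^ 2 / a * ((t : ℂ) ^ (a : ℂ) *
        jacobiSum (a : ℂ) r 1 t - jacobiSum (a : ℂ) r t 1)) := by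
    field_simp
  have hωn : ‖1 - (t : ℂ) ^ (a : ℂ)‖ = 1 - Real.exp (L * a) := by
    have : 1 - (t : ℂ) ^ (a : ℂ) = ((1 - Real.exp (L * a) : ℝ) : ℂ) := by
      rw [hω]; push_cast; rfl
    rw [this, Complex.norm_real, Real.norm_of_nonneg]
    have : Real.exp (L * a) ≤ 1 := Real.exp_le_one_iff.2 (by nlinarith)
    linarith
  rw [hfin, norm_mul, Complex.norm_real, Real.norm_of_nonneg ha₀.le, hωn]
  calc _ ≤ a * (m ^ r * (1 - Real.exp (L * a)) / a) := by gcongr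
    _ = _ := by field_simp

/-! ### Integrality of hypergeometric forms -/

theorem hypX_coeff_eq_coefficient (n r k : ℕ) (hk : k ≤ r) :
    (hypX n r).coeff k = ordinaryHypergeometricCoefficient
        (-(r : ℚ)) (-(r : ℚ) - 1 / (n : ℚ)) (1 - 1 / (n : ℚ)) k := by
  rw [hypX, finsetSum_coeff]
  simp only [coeff_C_mul, coeff_X_pow]
  rw [sum_eq_single k]
  · simp
  · intro b _ hb; simp [hb.symm]
  · intro h; exact absurd (mem_range.2 (by omega)) h

theorem hypX_coeff {n r k : ℕ} (hn : 2 ≤ n) (hk : k ≤ r) :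
    (hypX n r).coeff k = (r.factorial : ℚ) * (∏ i ∈ range r, ((i : ℚ) + 1 + 1 / n)) *
        (jacobiWeight (-(1 / (n : ℚ))) k * jacobiWeight (1 / (n : ℚ)) (r - k)) := by
  rw [hypX_coeff_eq_coefficient n r k hk, ordinaryHypergeometricCoefficient_eq hn hk]

theorem hypX_natDegree_le (n r : ℕ) : (hypX n r).natDegree ≤ r := by
  refine natDegree_sum_le_of_forall_le _ _ fun k hk => ?_
  exact (natDegree_C_mul_X_pow_le _ _).trans (by have := mem_range.1 hk; omega)

theorem hypX_comp_natDegree_le (d n r : ℕ) :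
    ((hypX n r).comp (1 - C (d : ℚ) * X)).natDegree ≤ r := by
  refine natDegree_comp_le.trans ?_
  have h1 : (1 - C (d : ℚ) * X).natDegree ≤ 1 := by compute_degree
  calc _ ≤ r * 1 := Nat.mul_le_mul (hypX_natDegree_le n r) h1
    _ = r := mul_one r

theorem hypX_eval_zero (n r : ℕ) : (hypX n r).eval 0 = 1 := by
  rw [← coeff_zero_eq_eval_zero, hypX_coeff_eq_coefficient n r 0 (Nat.zero_le _)]
  simp [ordinaryHypergeometricCoefficient]

/-- The binary form `v ^ r X_{n,r}(u / v)`. -/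
noncomputable def hypForm {F : Type*} [Field F] (n r : ℕ) (u v : F) : F :=
  ∑ k ∈ range (r + 1), ((hypX n r).coeff k : F) * u ^ k * v ^ (r - k)

theorem map_hypForm {F F' : Type*} [Field F] [Field F'] (f : F →+* F') (n r : ℕ) (u v : F) :
    f (hypForm n r u v) = hypForm n r (f u) (f v) := by
  simp [hypForm]

theorem hypForm_eq_jacobiSum {n : ℕ} (hn : 2 ≤ n) (r : ℕ) (u v : ℂ) :
    hypForm n r u v = r.factorial * (∏ i ∈ range r, ((i : ℂ) + 1 + 1 / n)) *
      jacobiSum (1 / (n : ℂ)) r u v := by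
  rw [hypForm, jacobiSum, Finset.Nat.sum_antidiagonal_eq_sum_range_succ_mk, mul_sum]
  refine sum_congr rfl fun k hk => ?_
  rw [hypX_coeff hn (by have := mem_range.1 hk; omega)]
  have h1 := map_jacobiWeight (algebraMap ℚ ℂ) (-(1 / (n : ℚ))) k
  have h2 := map_jacobiWeight (algebraMap ℚ ℂ) (1 / (n : ℚ)) (r - k)
  simp only [eq_ratCast] at h1 h2
  push_cast at h1 h2 ⊢
  rw [h1, h2]
  ring

theorem hypForm_eq_jacobiForm {n : ℕ} (hn : 2 ≤ n) (r : ℕ) (u v : ℂ) :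
    hypForm n r u v = r.factorial / (∏ i ∈ range r, ((i : ℂ) + 1 - 1 / n)) *
      jacobiForm (1 / (n : ℂ)) r u v := by
  have : ∏ i ∈ range r, ((i : ℂ) + 1 - 1 / n) ≠ 0 :=
    prod_ne_zero_iff.2 fun i _ => natCast_add_one_sub_ne_zero hn i
  rw [hypForm_eq_jacobiSum hn, jacobiForm]
  field_simp

theorem hypForm_mul {F : Type*} [Field F] (n r : ℕ) (c u v : F) :
    hypForm n r (c * u) (c * v) = c ^ r * hypForm n r u v := by
  rw [hypForm, hypForm, mul_sum]
  refine sum_congr rfl fun k hk => ?_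
  obtain ⟨m, rfl⟩ : ∃ m, r = k + m := ⟨r - k, by have := mem_range.1 hk; omega⟩
  rw [Nat.add_sub_cancel_left]
  ring

/-- The form at `(v - d w, v)` has the coefficients of `X_{n,r}(1 - d x)`. -/
theorem hypForm_sub_mul (d n r : ℕ) (v w : ℂ) (hv : v ≠ 0) :
    hypForm n r (v - d * w) v
      = ∑ k ∈ range (r + 1), ((((hypX n r).comp (1 - C (d : ℚ) * X)).coeff k : ℚ) : ℂ)
        * w ^ k * v ^ (r - k) := by
  have hhom : ∀ (p : ℚ[X]), p.natDegree ≤ r → ∀ u : ℂ,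
      ∑ k ∈ range (r + 1), ((p.coeff k : ℚ) : ℂ) * u ^ k * v ^ (r - k)
        = v ^ r * aeval (u / v) p := by
    intro p hp u
    rw [aeval_eq_sum_range' (n := r + 1) (by omega), mul_sum]
    refine sum_congr rfl fun k hk => ?_
    obtain ⟨m, rfl⟩ : ∃ m, r = k + m := ⟨r - k, by have := mem_range.1 hk; omega⟩
    rw [Nat.add_sub_cancel_left, Algebra.smul_def, eq_ratCast, pow_add, div_pow]
    field_simp
  have hdeg := hypX_comp_natDegree_le d n r
  rw [hypForm, hhom _ (hypX_natDegree_le n r), hhom _ hdeg, aeval_comp]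
  congr 2
  simp
  field_simp

theorem denomX_spec (n r : ℕ) :
    0 < denomX n r ∧ ∀ k : ℕ, ∃ z : ℤ, (denomX n r : ℚ) * (hypX n r).coeff k = z := by
  have hne : {D : ℕ | 0 < D ∧ ∀ k : ℕ, ∃ z : ℤ, (D : ℚ) * (hypX n r).coeff k = (z : ℚ)}.Nonempty := by
    refine ⟨∏ k ∈ range (r + 1), ((hypX n r).coeff k).den, prod_pos fun k _ => Rat.den_pos _,
      fun k => ?_⟩
    by_cases hk : k ∈ range (r + 1)
    · obtain ⟨m, hm⟩ := dvd_prod_of_mem (fun k => ((hypX n r).coeff k).den) hk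
      refine ⟨m * ((hypX n r).coeff k).num, ?_⟩
      rw [hm]
      push_cast
      rw [mul_right_comm, Rat.den_mul_eq_num, mul_comm]
    · refine ⟨0, ?_⟩
      rw [coeff_eq_zero_of_natDegree_lt, mul_zero, Int.cast_zero]
      have := hypX_natDegree_le n r
      simp at hk
      omega
  exact Nat.sInf_mem hne

theorem numerX_dvd_num (d n r k : ℕ) :
    (numerX d n r : ℤ) ∣ (((hypX n r).comp (1 - C (d : ℚ) * X)).coeff k).num := by
  by_cases hk : k ∈ range (r + 1)
  · exact Int.natCast_dvd.2 (gcd_dvd hk)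
  · have hdeg := hypX_comp_natDegree_le d n r
    rw [coeff_eq_zero_of_natDegree_lt]
    · simp
    · simp at hk; omega

/-- `D_{n,r} / N_{d,n,r}` times `X_{n,r}(1 - d x)` has integer coefficients. -/
theorem exists_denomX_mul_coeff_comp (d n r k : ℕ) :
    ∃ z : ℤ, (denomX n r : ℚ) * ((hypX n r).comp (1 - C (d : ℚ) * X)).coeff k
      = numerX d n r * z := by
  obtain ⟨hD, hz⟩ := denomX_spec n r
  set e := ((hypX n r).comp (1 - C (d : ℚ) * X)).coeff k with he
  obtain ⟨y, hy⟩ : ∃ y : ℤ, (denomX n r : ℚ) * e = y := by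
    choose c hc using hz
    set p : ℤ[X] := ∑ i ∈ range (r + 1), C (c i) * X ^ i with hp
    have hmap : p.map (Int.castRingHom ℚ) = C (denomX n r : ℚ) * hypX n r := by
      ext i
      rw [coeff_map, hp, finsetSum_coeff, coeff_C_mul, hc]
      simp only [coeff_C_mul, coeff_X_pow]
      by_cases hi : i ∈ range (r + 1)
      · rw [sum_eq_single i]
        · simp
        · intro b _ hb; simp [hb.symm]
        · intro h; exact absurd hi h
      · rw [sum_eq_zero]
        · have h0 : (hypX n r).coeff i = 0 := by
            apply coeff_eq_zero_of_natDegree_lt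
            have := hypX_natDegree_le n r
            simp at hi; omega
          have := hc i
          rw [h0, mul_zero] at this
          simp [← this]
        · intro j hj
          have : i ≠ j := by rintro rfl; exact hi hj
          simp [this]
    refine ⟨(p.comp (1 - C (d : ℤ) * X)).coeff k, ?_⟩
    have h2 : ((p.comp (1 - C (d : ℤ) * X)).map (Int.castRingHom ℚ))
        = C (denomX n r : ℚ) * (hypX n r).comp (1 - C (d : ℚ) * X) := by
      rw [Polynomial.map_comp, hmap, mul_comp, C_comp]
      simp
    have h3 := congrArg (fun q => q.coeff k) h2
    simp only [coeff_map, coeff_C_mul] at h3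
    rw [he, ← h3]
    simp
  obtain ⟨m, hm⟩ := numerX_dvd_num d n r k
  rw [← he] at hm
  have h1 : (denomX n r : ℤ) * e.num = y * e.den := by
    have : (denomX n r : ℚ) * e.num = y * e.den := by
      rw [← hy, mul_assoc, Rat.mul_den_eq_num]
    exact_mod_cast this
  have h2 : (e.den : ℤ) ∣ denomX n r := by
    have hcop : IsCoprime (e.den : ℤ) e.num := by
      rw [Int.isCoprime_iff_gcd_eq_one, Int.gcd_comm]
      exact e.reduced
    exact hcop.dvd_of_dvd_mul_right (Dvd.intro_left y h1.symm)
  obtain ⟨q, hq⟩ := h2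
  refine ⟨q * m, ?_⟩
  have hq' : (denomX n r : ℚ) = e.den * q := by exact_mod_cast hq
  have hm' : (e.num : ℚ) = numerX d n r * m := by exact_mod_cast hm
  rw [hq', mul_right_comm, Rat.den_mul_eq_num, hm']
  push_cast
  ring

/-- From `X_{n,r}(0) = 1`: substituting `x = 1 / d` in `X_{n,r}(1 - d x)` expresses `d ^ r` through
its coefficients, whose denominators are prime to `N_{d,n,r}`. -/
theorem numerX_dvd_pow {d : ℕ} (hd : 0 < d) (n r : ℕ) : numerX d n r ∣ d ^ r := by
  set e : ℕ → ℚ := fun k => ((hypX n r).comp (1 - C (d : ℚ) * X)).coeff k with he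
  have hd0 : (d : ℚ) ≠ 0 := by exact_mod_cast hd.ne'
  have hdeg := hypX_comp_natDegree_le d n r
  have h1 : (d : ℚ) ^ r = ∑ k ∈ range (r + 1), e k * d ^ (r - k) := by
    have h2 : ((hypX n r).comp (1 - C (d : ℚ) * X)).eval (d : ℚ)⁻¹ = 1 := by
      rw [eval_comp]
      simp [hd0, hypX_eval_zero]
    rw [eval_eq_sum_range' (n := r + 1) (by omega)] at h2
    rw [← mul_one ((d : ℚ) ^ r), ← h2, mul_sum]
    refine sum_congr rfl fun k hk => ?_
    obtain ⟨m, rfl⟩ : ∃ m, r = k + m := ⟨r - k, by have := mem_range.1 hk; omega⟩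
    rw [Nat.add_sub_cancel_left, pow_add, inv_pow]
    field_simp
    rfl
  set l := ∏ k ∈ range (r + 1), (e k).den with hl
  have hcop : IsCoprime (numerX d n r : ℤ) (l : ℤ) := by
    rw [hl]
    push_cast
    refine IsCoprime.prod_right fun k _ => ?_
    have : IsCoprime (e k).num ((e k).den : ℤ) := by
      rw [Int.isCoprime_iff_gcd_eq_one]
      exact (e k).reduced
    exact this.of_isCoprime_of_dvd_left (numerX_dvd_num d n r k)
  have hdvd : (numerX d n r : ℤ) ∣ (l : ℤ) * (d : ℤ) ^ r := by
    have h3 : ∀ k ∈ range (r + 1), ∃ z : ℤ, (l : ℚ) * e k = numerX d n r * z := by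
      intro k hk
      obtain ⟨m, hm⟩ := dvd_prod_of_mem (fun k => (e k).den) hk
      obtain ⟨y, hy⟩ := numerX_dvd_num d n r k
      refine ⟨m * y, ?_⟩
      have hy' : ((e k).num : ℚ) = numerX d n r * y := by exact_mod_cast hy
      rw [hl, hm]
      push_cast
      rw [mul_right_comm, Rat.den_mul_eq_num, hy']
      ring
    choose! z hz using h3
    refine ⟨∑ k ∈ range (r + 1), z k * d ^ (r - k), ?_⟩
    have : (l : ℚ) * (d : ℚ) ^ r = numerX d n r * ∑ k ∈ range (r + 1), z k * (d : ℚ) ^ (r - k) := by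
      rw [h1, mul_sum, mul_sum]
      refine sum_congr rfl fun k hk => ?_
      rw [← mul_assoc, hz k hk]
      ring
    exact_mod_cast this
  exact_mod_cast hcop.dvd_of_dvd_mul_left hdvd

theorem numerX_pos {d : ℕ} (hd : 0 < d) (n r : ℕ) : 0 < numerX d n r :=
  Nat.pos_of_dvd_of_pos (numerX_dvd_pow hd n r) (by positivity)

theorem isIntegral_denomX_div_numerX_mul_hypForm {d : ℕ} (hd : 0 < d) (n r : ℕ) {v w : ℂ}
    (hv0 : v ≠ 0) (hv : IsIntegral ℤ v) (hw : IsIntegral ℤ w) :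
    IsIntegral ℤ ((denomX n r : ℂ) / numerX d n r * hypForm n r (v - d * w) v) := by
  rw [hypForm_sub_mul d n r v w hv0, mul_sum]
  refine IsIntegral.sum _ fun k _ => ?_
  obtain ⟨z, hz⟩ := exists_denomX_mul_coeff_comp d n r k
  have hN : (numerX d n r : ℂ) ≠ 0 := by exact_mod_cast (numerX_pos hd n r).ne'
  have hz' : (denomX n r : ℂ) * ((((hypX n r).comp (1 - C (d : ℚ) * X)).coeff k : ℚ) : ℂ)
      = numerX d n r * z := by exact_mod_cast congrArg (fun q : ℚ => (q : ℂ)) hz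
  have : (denomX n r : ℂ) / numerX d n r *
      (((((hypX n r).comp (1 - C (d : ℚ) * X)).coeff k : ℚ) : ℂ) * w ^ k * v ^ (r - k))
      = z * (w ^ k * v ^ (r - k)) := by
    field_simp
    linear_combination w ^ k * hz'
  rw [this]
  have hzi : IsIntegral ℤ (z : ℂ) := isIntegral_algebraMap (R := ℤ) (A := ℂ) (x := z)
  exact hzi.mul ((hw.pow _).mul (hv.pow _))

/-! ### Exponential growth of the denominators -/

theorem factorial_mul_centralBinom (r : ℕ) :
    r.factorial * r.centralBinom = ∏ i ∈ range r, (4 * i + 2) := by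
  induction r with
  | zero => simp
  | succ r ih =>
    rw [prod_range_succ, ← ih, Nat.factorial_succ]
    have := Nat.succ_mul_centralBinom_succ r
    linear_combination r.factorial * this

theorem coprime_prod_mul_sub_one (n r : ℕ) (hn : 2 ≤ n) :
    (∏ i ∈ range r, (n * i + (n - 1))).Coprime n := by
  refine Nat.Coprime.prod_left fun i _ => ?_
  rw [add_comm, Nat.coprime_add_mul_left_left, Nat.coprime_self_sub_left (by omega)]
  exact Nat.coprime_one_left n

/-- `X_{n,r}(1) = n ^ r (2r)! / (r! ∏ (n j - 1))` by `jacobiForm_one_one`, and `D_{n,r} X_{n,r}(1)`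
is an integer; the product `∏ (n j - 1)` is prime to `n`. -/
theorem prod_dvd_denomX_mul {n : ℕ} (hn : 2 ≤ n) (r : ℕ) :
    ∏ i ∈ range r, (n * i + (n - 1)) ∣ denomX n r * ∏ i ∈ range r, (4 * i + 2) := by
  obtain ⟨-, hz⟩ := denomX_spec n r
  choose z hz using hz
  have hn0 : (n : ℂ) ≠ 0 := by exact_mod_cast (by omega : n ≠ 0)
  have h1 : (denomX n r : ℂ) * hypForm n r 1 1 = ((∑ k ∈ range (r + 1), z k : ℤ) : ℂ) := by
    rw [hypForm, mul_sum]
    push_cast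
    refine sum_congr rfl fun k _ => ?_
    rw [one_pow, one_pow, mul_one, mul_one]
    exact_mod_cast congrArg (fun q : ℚ => (q : ℂ)) (hz k)
  rw [hypForm_eq_jacobiForm hn, jacobiForm_one_one (natCast_add_one_add_ne_zero hn)
    (natCast_add_one_sub_ne_zero hn)] at h1
  set M := ∏ i ∈ range r, (n * i + (n - 1)) with hM
  have h2 : (n : ℂ) ^ r * ∏ i ∈ range r, ((i : ℂ) + 1 - 1 / n) = M := by
    rw [hM, ← card_range r, ← prod_const, card_range, ← prod_mul_distrib]
    push_cast
    refine prod_congr rfl fun i _ => ?_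
    rw [Nat.cast_sub (by omega)]
    field_simp
    push_cast
    ring
  have h3 : ∏ i ∈ range r, ((i : ℂ) + 1 - 1 / n) ≠ 0 :=
    prod_ne_zero_iff.2 fun i _ => natCast_add_one_sub_ne_zero hn i
  generalize ∏ i ∈ range r, ((i : ℂ) + 1 - 1 / n) = G at h1 h2 h3
  have h4 : (M : ℤ) ∣ ((denomX n r * (r.factorial * r.centralBinom) * n ^ r : ℕ) : ℤ) := by
    refine ⟨∑ k ∈ range (r + 1), z k, ?_⟩
    have : ((denomX n r * (r.factorial * r.centralBinom) * n ^ r : ℕ) : ℂ)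
        = M * ((∑ k ∈ range (r + 1), z k : ℤ) : ℂ) := by
      rw [← h1, ← h2]
      push_cast
      field_simp
    exact_mod_cast this
  have h5 := Int.natCast_dvd_natCast.1 h4
  rw [factorial_mul_centralBinom] at h5
  exact ((coprime_prod_mul_sub_one n r hn).pow_right r).dvd_of_dvd_mul_right h5

theorem three_pow_mul_prod_odd_dvd (r : ℕ) :
    3 ^ r * ∏ i ∈ range r, (2 * i + 1) ∣ ∏ i ∈ range (3 * r), (2 * i + 1) := by
  induction r with
  | zero => simp
  | succ r ih =>
    rw [show 3 * (r + 1) = 3 * r + 1 + 1 + 1 by ring, prod_range_succ, prod_range_succ,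
      prod_range_succ, prod_range_succ]
    obtain ⟨m, hm⟩ := ih
    rw [hm]
    exact ⟨m * (2 * (3 * r) + 1) * (2 * (3 * r + 1 + 1) + 1), by ring⟩

/-- Exponential growth of `D_{n,r}` along the multiples of `9`. For `n ≥ 5` it is enough to compare
the factors in `prod_dvd_denomX_mul`. For `n = 4` the power of `2` in `(2r)! / r!` is discarded
first, and for `n = 3` a power of `3`; its exponent is at least `4 r / 9` when `9 ∣ r`. -/
theorem pow_le_denomX {n : ℕ} (hn : 3 ≤ n) (s : ℕ) :
    ((6 : ℝ) / 5) ^ (9 * s) ≤ denomX n (9 * s) := by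
  have hdvd := prod_dvd_denomX_mul (by omega : 2 ≤ n) (9 * s)
  have hD : 0 < denomX n (9 * s) := (denomX_spec n (9 * s)).1
  have hlow : ∀ c : ℝ, 0 ≤ c → (∀ i : ℕ, c * (4 * i + 2) ≤ n * i + (n - 1)) → ∀ r : ℕ,
      c ^ r * ((∏ i ∈ range r, (4 * i + 2) : ℕ) : ℝ)
        ≤ ((∏ i ∈ range r, (n * i + (n - 1)) : ℕ) : ℝ) := by
    intro c hc h r
    push_cast
    have : c ^ r = ∏ i ∈ range r, c := by simp
    rw [this, ← prod_mul_distrib]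
    refine prod_le_prod (fun i _ => by positivity) fun i _ => ?_
    rw [Nat.cast_sub (by omega)]
    exact_mod_cast h i
  have hfpos : 0 < ∏ i ∈ range (9 * s), (4 * i + 2) := prod_pos fun i _ => by omega
  rcases (by omega : n = 3 ∨ n = 4 ∨ 5 ≤ n) with rfl | rfl | hn5
  · have h3 : 3 ^ (4 * s) ∣ ∏ i ∈ range (9 * s), (4 * i + 2) := by
      have e : ∏ i ∈ range (9 * s), (4 * i + 2) = 2 ^ (9 * s) * ∏ i ∈ range (9 * s), (2 * i + 1) := by
        rw [← card_range (9 * s), ← prod_const, card_range, ← prod_mul_distrib]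
        exact prod_congr rfl fun i _ => by ring
      rw [e]
      refine Dvd.dvd.mul_left ?_ _
      have d1 := three_pow_mul_prod_odd_dvd (3 * s)
      have d2 := three_pow_mul_prod_odd_dvd s
      rw [← mul_assoc] at d1
      refine dvd_trans ?_ d1
      refine dvd_trans ?_ (mul_dvd_mul_left _ d2)
      exact ⟨∏ i ∈ range s, (2 * i + 1), by ring⟩
    obtain ⟨q, hq⟩ := h3
    have hl := hlow (3 / 4) (by norm_num) (fun i => by push_cast; linarith) (9 * s)
    rw [hq] at hl hdvd hfpos
    have hc : (∏ i ∈ range (9 * s), (3 * i + (3 - 1))).Coprime (3 ^ (4 * s)) :=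
      (coprime_prod_mul_sub_one 3 (9 * s) (by norm_num)).pow_right _
    rw [mul_left_comm] at hdvd
    have hq0 : 0 < q := Nat.pos_of_mul_pos_left hfpos
    have hle := Nat.le_of_dvd (by positivity) (hc.dvd_of_dvd_mul_left hdvd)
    have hle' : ((∏ i ∈ range (9 * s), (3 * i + (3 - 1)) : ℕ) : ℝ) ≤ denomX 3 (9 * s) * q := by
      exact_mod_cast hle
    have h6 := hl.trans hle'
    push_cast at h6
    rw [← mul_assoc] at h6
    have h7 := le_of_mul_le_mul_right h6 (by exact_mod_cast hq0 : (0 : ℝ) < q)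
    refine le_trans ?_ h7
    rw [pow_mul, pow_mul, pow_mul, ← mul_pow]
    gcongr
    norm_num
  · have e : ∏ i ∈ range (9 * s), (4 * i + 2) = 2 ^ (9 * s) * ∏ i ∈ range (9 * s), (2 * i + 1) := by
      rw [← card_range (9 * s), ← prod_const, card_range, ← prod_mul_distrib]
      exact prod_congr rfl fun i _ => by ring
    have hl := hlow 1 (by norm_num) (fun i => by push_cast; linarith) (9 * s)
    rw [e] at hl hdvd hfpos
    have hc : (∏ i ∈ range (9 * s), (4 * i + (4 - 1))).Coprime (2 ^ (9 * s)) :=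
      ((coprime_prod_mul_sub_one 4 (9 * s) (by norm_num)).coprime_dvd_right
        (by norm_num : 2 ∣ 4)).pow_right _
    rw [mul_left_comm] at hdvd
    have hq0 : 0 < ∏ i ∈ range (9 * s), (2 * i + 1) := Nat.pos_of_mul_pos_left hfpos
    have hle := Nat.le_of_dvd (by positivity) (hc.dvd_of_dvd_mul_left hdvd)
    generalize ∏ i ∈ range (9 * s), (2 * i + 1) = q at *
    have hle' : ((∏ i ∈ range (9 * s), (4 * i + (4 - 1)) : ℕ) : ℝ) ≤ denomX 4 (9 * s) * q := by
      exact_mod_cast hle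
    have h6 := hl.trans hle'
    push_cast at h6
    rw [one_pow, one_mul] at h6
    have h7 := le_of_mul_le_mul_right h6 (by exact_mod_cast hq0 : (0 : ℝ) < q)
    refine le_trans ?_ h7
    gcongr
    norm_num
  · have hn5' : (5 : ℝ) ≤ n := by exact_mod_cast hn5
    have hl := hlow (6 / 5) (by norm_num) (fun i => by
      have : (0 : ℝ) ≤ i := i.cast_nonneg
      nlinarith) (9 * s)
    have hle := Nat.le_of_dvd (by positivity) hdvd
    have hle' : ((∏ i ∈ range (9 * s), (n * i + (n - 1)) : ℕ) : ℝ)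
        ≤ denomX n (9 * s) * (∏ i ∈ range (9 * s), (4 * i + 2) : ℕ) := by
      exact_mod_cast hle
    exact le_of_mul_le_mul_right (hl.trans hle') (by exact_mod_cast hfpos)

/-! ### Algebraic integers with square in `ℚ` or an imaginary quadratic field -/

/-- `t * conj t` is rational for `t` in `ℚ` or in an imaginary quadratic field. -/
theorem exists_rat_eq_mul_conj {K : IntermediateField ℚ ℂ} (hK : IsRatOrImagQuadratic K) {t : ℂ}
    (ht : t ∈ K) : ∃ q : ℚ, t * (starRingEnd ℂ) t = q := by
  rcases hK with rfl | ⟨hfin, z, hz, him⟩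
  · obtain ⟨q, rfl⟩ := IntermediateField.mem_bot.1 ht
    exact ⟨q * q, by simp⟩
  · have hli : LinearIndependent ℚ ![(1 : K), ⟨z, hz⟩] := by
      rw [LinearIndependent.pair_iff]
      intro a b hab
      have h1 : (a : ℂ) + b * z = 0 := by
        have := congrArg (fun y : K => (y : ℂ)) hab
        simpa [Algebra.smul_def] using this
      have h2 := congrArg Complex.im h1
      simp at h2
      have hb : b = 0 := by
        rcases h2 with h2 | h2
        · exact h2
        · exact absurd h2 him
      subst hb
      simp at h1
      exact ⟨h1, rfl⟩
    have hspan := hli.span_eq_top_of_card_eq_finrank (by simp [hfin])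
    have hrep : ∀ w ∈ K, ∃ a b : ℚ, w = a + b * z := by
      intro w hw
      have : (⟨w, hw⟩ : K) ∈ Submodule.span ℚ (Set.range ![(1 : K), ⟨z, hz⟩]) := by
        rw [hspan]; trivial
      simp only [Matrix.range_cons, Matrix.range_empty, Set.union_empty,
        Set.singleton_union] at this
      obtain ⟨a, b, h⟩ := Submodule.mem_span_pair.1 this
      refine ⟨a, b, ?_⟩
      have := congrArg (fun y : K => (y : ℂ)) h
      simpa [Algebra.smul_def] using this.symm
    obtain ⟨a, b, rfl⟩ := hrep t ht
    obtain ⟨α, β, h⟩ := hrep (z ^ 2) (K.pow_mem hz 2)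
    have hre := congrArg Complex.re h
    have hi := congrArg Complex.im h
    simp [pow_two] at hre hi
    have htr : 2 * z.re = β := by
      apply mul_right_cancel₀ him
      linear_combination hi
    refine ⟨a ^ 2 + a * b * β - b ^ 2 * α, ?_⟩
    rw [Complex.mul_conj]
    have hn : Complex.normSq (a + b * z) = ((a ^ 2 + a * b * β - b ^ 2 * α : ℚ) : ℝ) := by
      rw [Complex.normSq_apply]
      simp
      linear_combination (a * b + b ^ 2 * z.re : ℝ) * htr - (b : ℝ) ^ 2 * hre
    rw [hn]
    norm_cast

/-- The gap principle: a non-zero algebraic integer whose square lies in `K` has absolute value at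
least `1`. -/
theorem one_le_norm_of_sq_mem {K : IntermediateField ℚ ℂ} (hK : IsRatOrImagQuadratic K) {T : ℂ}
    (hT : IsIntegral ℤ T) (hTK : T ^ 2 ∈ K) (hT0 : T ≠ 0) : 1 ≤ ‖T‖ := by
  obtain ⟨q, hq⟩ := exists_rat_eq_mul_conj hK hTK
  have hconj : IsIntegral ℤ ((starRingEnd ℂ) (T ^ 2)) :=
    (hT.pow 2).map ((starRingEnd ℂ).toIntAlgHom)
  have hint : IsIntegral ℤ (algebraMap ℚ ℂ q) := by
    have := (hT.pow 2).mul hconj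
    rw [hq] at this
    simpa using this
  rw [isIntegral_algebraMap_iff (algebraMap ℚ ℂ).injective] at hint
  obtain ⟨m, hm⟩ := IsIntegrallyClosed.isIntegral_iff.1 hint
  have h1 : ((‖T‖ ^ 4 : ℝ) : ℂ) = (m : ℂ) := by
    rw [Complex.mul_conj, Complex.normSq_eq_norm_sq, norm_pow, ← hm] at hq
    push_cast at hq ⊢
    rw [← pow_mul] at hq
    simpa using hq
  have h2 : ‖T‖ ^ 4 = m := by exact_mod_cast h1
  have h3 : 0 < ‖T‖ ^ 4 := by positivity
  rw [h2] at h3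
  have h4 : (1 : ℤ) ≤ m := by exact_mod_cast h3
  have h5 : (1 : ℝ) ≤ ‖T‖ ^ 4 := by rw [h2]; exact_mod_cast h4
  by_contra hlt
  push Not at hlt
  exact absurd h5 (not_le.2 (pow_lt_one₀ (norm_nonneg _) hlt (by norm_num)))

/-- A non-trivial automorphism of a quadratic extension is an involution, and it fixes only `K`. -/
theorem mem_of_apply_eq_self {K : IntermediateField ℚ ℂ} {β : ℂ}
    (hfin : Module.finrank K K⟮β⟯ = 2) {σ : K⟮β⟯ ≃ₐ[K] K⟮β⟯} (hσ : σ ≠ AlgEquiv.refl) :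
    (∀ y : K⟮β⟯, σ (σ y) = y) ∧ ∀ y : K⟮β⟯, σ y = y → (y : ℂ) ∈ K := by
  classical
  have : FiniteDimensional K K⟮β⟯ := FiniteDimensional.of_finrank_pos (by omega)
  have hnt : Nontrivial (K⟮β⟯ ≃ₐ[K] K⟮β⟯) := ⟨σ, AlgEquiv.refl, hσ⟩
  have hle : Nat.card (K⟮β⟯ ≃ₐ[K] K⟮β⟯) ≤ 2 := by
    rw [← hfin, Nat.card_eq_fintype_card]
    exact AlgEquiv.card_le
  have hlt : 1 < Nat.card (K⟮β⟯ ≃ₐ[K] K⟮β⟯) := Finite.one_lt_card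
  have hcard : Nat.card (K⟮β⟯ ≃ₐ[K] K⟮β⟯) = 2 := by omega
  have hsq : σ ^ 2 = 1 := hcard ▸ pow_card_eq_one'
  have hgal : IsGalois K K⟮β⟯ := IsGalois.of_card_aut_eq_finrank _ _ (by rw [hcard, hfin])
  have hall : ∀ τ : K⟮β⟯ ≃ₐ[K] K⟮β⟯, τ = 1 ∨ τ = σ := by
    intro τ
    by_contra h
    push Not at h
    have h3 : ({1, σ, τ} : Finset (K⟮β⟯ ≃ₐ[K] K⟮β⟯)).card = 3 := by
      rw [Finset.card_eq_three]
      exact ⟨1, σ, τ, fun h' => hσ h'.symm, fun h' => h.1 h'.symm, fun h' => h.2 h'.symm, rfl⟩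
    have h4 := Finset.card_le_univ ({1, σ, τ} : Finset (K⟮β⟯ ≃ₐ[K] K⟮β⟯))
    rw [← Nat.card_eq_fintype_card] at h4
    omega
  refine ⟨fun y => ?_, fun y hy => ?_⟩
  · have := DFunLike.congr_fun hsq y
    rwa [pow_two] at this
  · have hbot : y ∈ (⊥ : IntermediateField K K⟮β⟯) := by
      rw [IsGalois.mem_bot_iff_fixed]
      intro τ
      rcases hall τ with rfl | rfl
      · rfl
      · exact hy
    obtain ⟨k, hk⟩ := IntermediateField.mem_bot.1 hbot
    rw [← hk]
    exact k.2

/-! ### Linear forms and measures of irrationality -/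

/-- In the quadratic case `σ` maps `U` to `-Z` and `Z` to `-U`, so it maps the linear form below to
plus or minus itself, and its square lies in `K`. -/
theorem sq_mem_of_conjugate {K : IntermediateField ℚ ℂ} {β₁ β₂ γ₁ γ₂ x : ℂ} {n : ℕ}
    (hβ₁ : IsIntegral ℤ β₁) (hdeg : Module.finrank K K⟮β₁⟯ ≤ 2)
    (h_deg_one : β₁ ∈ K →
      β₂ ∈ K ∧ γ₁ ∈ K ∧ γ₂ ∈ K ∧ γ₁ ≠ 0 ∧ γ₂ ≠ 0 ∧ β₂ ≠ β₁ ∧ IsIntegral ℤ β₂)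
    (h_deg_two : Module.finrank K K⟮β₁⟯ = 2 →
      ∃ σ : K⟮β₁⟯ ≃ₐ[K] K⟮β₁⟯, σ ≠ AlgEquiv.refl ∧
        β₂ = (σ (IntermediateField.AdjoinSimple.gen K β₁) : ℂ) ∧
        ∃ γ : K⟮β₁⟯, γ₁ = (γ : ℂ) ∧ γ₂ = (σ γ : ℂ))
    (hxK : x ∈ K) {U Z : ℂ} (hU : U = -γ₂ * (x - β₂) ^ n) (hZ : Z = γ₁ * (x - β₁) ^ n) :
    β₁ ≠ β₂ ∧ IsIntegral ℤ β₂ ∧ (U - Z) ^ 2 ∈ K ∧ ∀ p q : ℂ, p ∈ K → q ∈ K → ∀ r : ℕ,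
      ((q * β₁ - p) * (x - β₂) * hypForm n r Z U - (q * β₂ - p) * (x - β₁) * hypForm n r U Z) ^ 2
        ∈ K := by
  by_cases hmem : β₁ ∈ K
  · obtain ⟨hβ₂, hγ₁, hγ₂, -, -, hne, hint⟩ := h_deg_one hmem
    have hUK : U ∈ K := hU ▸ K.mul_mem (K.neg_mem hγ₂) (pow_mem (K.sub_mem hxK hβ₂) n)
    have hZK : Z ∈ K := hZ ▸ K.mul_mem hγ₁ (pow_mem (K.sub_mem hxK hmem) n)
    have hform : ∀ r u v, u ∈ K → v ∈ K → hypForm n r u v ∈ K := fun r u v hu hv =>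
      K.sum_mem fun k _ => K.mul_mem (K.mul_mem (by simp) (pow_mem hu _)) (pow_mem hv _)
    refine ⟨hne.symm, hint, pow_mem (K.sub_mem hUK hZK) 2, fun p q hp hq r => pow_mem ?_ 2⟩
    exact K.sub_mem (K.mul_mem (K.mul_mem (K.sub_mem (K.mul_mem hq hmem) hp) (K.sub_mem hxK hβ₂))
      (hform r _ _ hZK hUK)) (K.mul_mem (K.mul_mem (K.sub_mem (K.mul_mem hq hβ₂) hp)
      (K.sub_mem hxK hmem)) (hform r _ _ hUK hZK))
  · have hβK : IsIntegral K β₁ := hβ₁.tower_top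
    have hfd : FiniteDimensional K K⟮β₁⟯ := IntermediateField.adjoin.finiteDimensional hβK
    have hfin : Module.finrank K K⟮β₁⟯ = 2 := by
      have h0 : 0 < Module.finrank K K⟮β₁⟯ := Module.finrank_pos
      have h1 : Module.finrank K K⟮β₁⟯ ≠ 1 := by
        rw [Ne, IntermediateField.finrank_adjoin_simple_eq_one_iff, IntermediateField.mem_bot]
        rintro ⟨k, hk⟩
        exact hmem (hk ▸ k.2)
      omega
    obtain ⟨σ, hσ, hβ₂, γ, hγ₁, hγ₂⟩ := h_deg_two hfin
    obtain ⟨hinv, hfix⟩ := mem_of_apply_eq_self hfin hσ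
    set b := IntermediateField.AdjoinSimple.gen K β₁ with hb
    have hbβ : (b : ℂ) = β₁ := IntermediateField.AdjoinSimple.coe_gen K β₁
    have hlift : ∀ y ∈ K, ∃ y' : K⟮β₁⟯, (y' : ℂ) = y ∧ σ y' = y' := fun y hy =>
      ⟨algebraMap K K⟮β₁⟯ ⟨y, hy⟩, rfl, σ.commutes _⟩
    obtain ⟨x', hx', hσx⟩ := hlift x hxK
    set u : K⟮β₁⟯ := -σ γ * (x' - σ b) ^ n with hu
    set z : K⟮β₁⟯ := γ * (x' - b) ^ n with hz
    have hUu : U = u := by rw [hU, hγ₂, hβ₂, ← hx', hu]; push_cast; rfl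
    have hZz : Z = z := by rw [hZ, hγ₁, hz]; push_cast; rw [hbβ, hx']
    have hσu : σ u = -z := by
      rw [hu, map_mul, map_neg, hinv, map_pow, map_sub, hinv, hσx, hz]; ring
    have hσz : σ z = -u := by
      rw [hz, map_mul, map_pow, map_sub, hσx, hu]; ring
    have hneg : ∀ (r : ℕ) (s t : K⟮β₁⟯), hypForm n r (-s) (-t) = (-1) ^ r * hypForm n r s t := by
      intro r s t
      rw [← hypForm_mul, neg_one_mul, neg_one_mul]
    have hcoe : ∀ (r : ℕ) (s t : K⟮β₁⟯), ((hypForm n r s t : K⟮β₁⟯) : ℂ) = hypForm n r (s : ℂ) t :=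
      fun r s t => map_hypForm (algebraMap K⟮β₁⟯ ℂ) n r s t
    have hσf : ∀ (r : ℕ) (s t : K⟮β₁⟯), σ (hypForm n r s t) = hypForm n r (σ s) (σ t) :=
      fun r s t => map_hypForm (σ : K⟮β₁⟯ →+* K⟮β₁⟯) n r s t
    have hne : β₁ ≠ β₂ := by
      intro h
      have : σ b = b := Subtype.ext (by rw [← hβ₂, hbβ, h])
      exact hmem (hbβ ▸ hfix b this)
    have hint : IsIntegral ℤ β₂ := by
      rw [hβ₂]
      have h1 : IsIntegral ℤ b := by
        have : IsIntegral ℤ (algebraMap K⟮β₁⟯ ℂ b) := by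
          show IsIntegral ℤ (b : ℂ)
          rwa [hbβ]
        exact (isIntegral_algebraMap_iff (algebraMap K⟮β₁⟯ ℂ).injective).1 this
      have h2 : IsIntegral ℤ (σ b) := h1.map ((σ : K⟮β₁⟯ →+* K⟮β₁⟯).toIntAlgHom)
      exact h2.map ((algebraMap K⟮β₁⟯ ℂ).toIntAlgHom)
    refine ⟨hne, hint, ?_, fun p q hp hq r => ?_⟩
    · have h1 : σ ((u - z) ^ 2) = (u - z) ^ 2 := by
        rw [map_pow, map_sub, hσu, hσz]; ring
      have := hfix _ h1
      push_cast at this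
      rwa [hUu, hZz]
    · obtain ⟨p', hp', hσp⟩ := hlift p hp
      obtain ⟨q', hq', hσq⟩ := hlift q hq
      have h1 : σ (((q' * b - p') * (x' - σ b) * hypForm n r z u
          - (q' * σ b - p') * (x' - b) * hypForm n r u z) ^ 2)
          = ((q' * b - p') * (x' - σ b) * hypForm n r z u
          - (q' * σ b - p') * (x' - b) * hypForm n r u z) ^ 2 := by
        simp only [map_pow, map_sub, map_mul, hσp, hσq, hσx, hinv, hσf, hσu, hσz, hneg]
        have : ((-1 : K⟮β₁⟯) ^ r) ^ 2 = 1 := by rw [← pow_mul, mul_comm, pow_mul]; simp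
        linear_combination ((q' * b - p') * (x' - σ b) * hypForm n r z u
          - (q' * σ b - p') * (x' - b) * hypForm n r u z) ^ 2 * this
      have := hfix _ h1
      push_cast [hcoe] at this
      rw [hbβ, ← hβ₂, hx', hp', hq'] at this
      rwa [hUu, hZz]

/-- Approximations `P r / R r` to `θ` with geometric bounds give a measure of irrationality. The
index is the first `r₀` with `L ‖q‖ ≤ E ^ r₀`, or its successor if `P r₀ / R r₀ = p / q`. That
`Q ≥ 1` is a consequence of the gap for `R r`. -/
theorem le_mul_norm_sub_div {θ p q : ℂ} {P R : ℕ → ℂ} {E Q k l L η : ℝ}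
    (hE : 1 < E) (hQ : 0 < Q) (hk : 0 ≤ k) (hη : 0 ≤ η) (hl : l ≤ η * L)
    (hR : ∀ r, ‖R r‖ ≤ k * Q ^ r) (hP : ∀ r, ‖R r * θ - P r‖ ≤ l / E ^ r)
    (hdet : ∀ r, P r * R (r + 1) - P (r + 1) * R r ≠ 0)
    (hRgap : ∀ r, R r ≠ 0 → 1 ≤ ‖R r‖)
    (hgap : ∀ r, q * P r - p * R r ≠ 0 → 1 ≤ ‖q * P r - p * R r‖) (hq : 1 ≤ ‖q‖) :
    1 - η ≤ k * Q * max 1 (L * E) ^ (Real.log Q / Real.log E)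
      * ‖q‖ ^ (Real.log Q / Real.log E + 1) * ‖θ - p / q‖ := by
  have hE0 : 0 < E := by linarith
  have hq0 : q ≠ 0 := by rintro rfl; simp at hq; linarith
  -- otherwise two consecutive `R r` would have norm less than `1`, hence vanish
  have hQ1 : 1 ≤ Q := by
    by_contra hlt
    push Not at hlt
    have t1 : Filter.Tendsto (fun r => k * Q ^ r) Filter.atTop (nhds 0) := by
      simpa using (tendsto_pow_atTop_nhds_zero_of_lt_one hQ.le hlt).const_mul k
    obtain ⟨r, ha, hb⟩ := ((t1.eventually_lt_const one_pos).and
      ((Filter.tendsto_add_atTop_nat 1).eventually (t1.eventually_lt_const one_pos))).exists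
    have z1 : ∀ s, k * Q ^ s < 1 → R s = 0 := fun s hs => by
      by_contra h0
      linarith [hRgap s h0, hR s]
    apply hdet r
    rw [z1 r ha, z1 (r + 1) hb]
    ring
  set κ := Real.log Q / Real.log E with hκ
  have hκ0 : 0 ≤ κ := div_nonneg (Real.log_nonneg hQ1) (Real.log_nonneg hE.le)
  have hEκ : E ^ κ = Q := by
    rw [Real.rpow_def_of_pos hE0, hκ, mul_div_cancel₀ _ (Real.log_pos hE).ne', Real.exp_log hQ]
  have hex : ∃ r : ℕ, L * ‖q‖ ≤ E ^ r := (pow_unbounded_of_one_lt (L * ‖q‖) hE).imp fun _ h => h.le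
  obtain ⟨r₀, hr₀, hQr₀⟩ : ∃ r₀ : ℕ, L * ‖q‖ ≤ E ^ r₀ ∧
      Q ^ r₀ ≤ max 1 (L * E) ^ κ * ‖q‖ ^ κ := by
    classical
    refine ⟨Nat.find hex, Nat.find_spec hex, ?_⟩
    rw [← Real.mul_rpow (by positivity) (by positivity)]
    rcases hr : Nat.find hex with _ | s
    · rw [pow_zero]
      refine Real.one_le_rpow ?_ hκ0
      exact one_le_mul_of_one_le_of_one_le (le_max_left _ _) hq
    · have h1 : E ^ s < L * ‖q‖ := by
        have := Nat.find_min hex (m := s) (by omega)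
        exact not_le.1 this
      have h2 : E ^ (s + 1) ≤ max 1 (L * E) * ‖q‖ := by
        calc E ^ (s + 1) = E ^ s * E := pow_succ _ _
          _ ≤ L * ‖q‖ * E := by gcongr
          _ = (L * E) * ‖q‖ := by ring
          _ ≤ _ := by gcongr; exact le_max_right _ _
      calc Q ^ (s + 1) = (E ^ (s + 1)) ^ κ := by
            rw [← hEκ, ← Real.rpow_natCast, ← Real.rpow_natCast, ← Real.rpow_mul hE0.le,
              ← Real.rpow_mul hE0.le, mul_comm]
        _ ≤ _ := by gcongr
  obtain ⟨r, hr, hr', hne⟩ : ∃ r, r₀ ≤ r ∧ r ≤ r₀ + 1 ∧ q * P r - p * R r ≠ 0 := by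
    by_contra hcon
    push Not at hcon
    have e1 := hcon r₀ le_rfl (by omega)
    have e2 := hcon (r₀ + 1) (by omega) le_rfl
    apply hdet r₀
    apply mul_left_cancel₀ hq0
    linear_combination R (r₀ + 1) * e1 - R r₀ * e2
  have h1 := hgap r hne
  have h2 : q * P r - p * R r = R r * (q * (θ - p / q)) - q * (R r * θ - P r) := by
    field_simp
    ring
  have h3 : ‖q‖ * (l / E ^ r) ≤ η := by
    rw [← mul_div_assoc, div_le_iff₀ (by positivity)]
    calc ‖q‖ * l ≤ ‖q‖ * (η * L) := by gcongr
      _ = η * (L * ‖q‖) := by ring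
      _ ≤ η * E ^ r₀ := by gcongr
      _ ≤ η * E ^ r := by gcongr; exact hE.le
  have h4 : ‖R r‖ ≤ k * (Q * (max 1 (L * E) ^ κ * ‖q‖ ^ κ)) := by
    refine (hR r).trans ?_
    gcongr
    calc Q ^ r ≤ Q ^ (r₀ + 1) := by gcongr
      _ = Q * Q ^ r₀ := pow_succ' _ _
      _ ≤ _ := by gcongr
  have h5 : ‖q * P r - p * R r‖ ≤ ‖R r‖ * (‖q‖ * ‖θ - p / q‖) + ‖q‖ * (l / E ^ r) := by
    rw [h2]
    refine (norm_sub_le _ _).trans ?_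
    rw [norm_mul, norm_mul, norm_mul q]
    gcongr
    exact hP r
  have h6 : ‖R r‖ * (‖q‖ * ‖θ - p / q‖)
      ≤ k * (Q * (max 1 (L * E) ^ κ * ‖q‖ ^ κ)) * (‖q‖ * ‖θ - p / q‖) := by gcongr
  have h7 : ‖q‖ ^ (κ + 1) = ‖q‖ ^ κ * ‖q‖ := by
    rw [Real.rpow_add (by linarith), Real.rpow_one]
  rw [h7]
  nlinarith

/-! ### Size of hypergeometric forms -/

theorem nthRoot_two_sq (w : ℂ) : nthRoot 2 w ^ 2 = w := by
  rw [nthRoot]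
  simp

/-- Square roots of two numbers of equal norm `ρ`: the two values are the roots of a quadratic
equation determined by `ρ` and `‖s ^ 2 + t ^ 2‖`, by the parallelogram law for `s, t` and for
`s ^ 2, t ^ 2`. -/
theorem max_min_sq_of_norm_eq {s t : ℂ} {ρ : ℝ} (hs : ‖s ^ 2‖ = ρ) (ht : ‖t ^ 2‖ = ρ) :
    max ‖s - t‖ ‖s + t‖ ^ 2 = 2 * ρ + ‖s ^ 2 + t ^ 2‖ ∧
      min ‖s - t‖ ‖s + t‖ ^ 2 = 2 * ρ - ‖s ^ 2 + t ^ 2‖ := by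
  have h1 := parallelogram_law_with_norm ℝ s t
  have h2 := parallelogram_law_with_norm ℝ (s ^ 2) (t ^ 2)
  have h3 : ‖s ^ 2 - t ^ 2‖ = ‖s - t‖ * ‖s + t‖ := by rw [← norm_mul]; congr 1; ring
  rw [hs, ht, h3] at h2
  rw [norm_pow] at hs ht
  set w := ‖s ^ 2 + t ^ 2‖ with hw
  have hw0 : 0 ≤ w := norm_nonneg _
  have h4 : (‖s + t‖ ^ 2 - ‖s - t‖ ^ 2) ^ 2 = (2 * w) ^ 2 := by
    have e : ‖s + t‖ ^ 2 + ‖s - t‖ ^ 2 = 4 * ρ := by rw [← hs] at ht ⊢; nlinarith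
    have : (‖s + t‖ ^ 2 - ‖s - t‖ ^ 2) ^ 2
      = (‖s + t‖ ^ 2 + ‖s - t‖ ^ 2) ^ 2 - 4 * (‖s - t‖ * ‖s + t‖) ^ 2 := by ring
    rw [this, e]
    nlinarith
  have e : ‖s + t‖ ^ 2 + ‖s - t‖ ^ 2 = 4 * ρ := by rw [← hs] at ht ⊢; nlinarith
  rcases le_total ‖s - t‖ ‖s + t‖ with hle | hle
  · have h5 : ‖s - t‖ ^ 2 ≤ ‖s + t‖ ^ 2 := by gcongr
    have h6 := (pow_left_inj₀ (by linarith) (by linarith) two_ne_zero).1 h4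
    rw [max_eq_right hle, min_eq_left hle]
    constructor <;> linarith
  · have h5 : ‖s + t‖ ^ 2 ≤ ‖s - t‖ ^ 2 := by gcongr
    have h7 : (‖s - t‖ ^ 2 - ‖s + t‖ ^ 2) ^ 2 = (2 * w) ^ 2 := by rw [← h4]; ring
    have h6 := (pow_left_inj₀ (by linarith) (by linarith) two_ne_zero).1 h7
    rw [max_eq_left hle, min_eq_right hle]
    constructor <;> linarith

theorem max_min_of_sq_eq_mul {s t : ℂ} {y : ℝ} (hy₀ : 0 ≤ y) (hy₁ : y ≤ 1)
    (h : t ^ 2 = (y : ℂ) ^ 2 * s ^ 2) :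
    max ‖s - t‖ ‖s + t‖ = ‖s‖ * (1 + y) ∧ min ‖s - t‖ ‖s + t‖ = ‖s‖ * (1 - y) := by
  have e1 : ‖s * (1 + y)‖ = ‖s‖ * (1 + y) := by
    rw [norm_mul, show (1 + y : ℂ) = ((1 + y : ℝ) : ℂ) by push_cast; rfl, Complex.norm_real,
      Real.norm_of_nonneg (by linarith)]
  have e2 : ‖s * (1 - y)‖ = ‖s‖ * (1 - y) := by
    rw [norm_mul, show (1 - y : ℂ) = ((1 - y : ℝ) : ℂ) by push_cast; rfl, Complex.norm_real,
      Real.norm_of_nonneg (by linarith)]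
  have hle : ‖s‖ * (1 - y) ≤ ‖s‖ * (1 + y) := by gcongr; linarith
  rw [← mul_pow] at h
  rcases sq_eq_sq_iff_eq_or_eq_neg.1 h with rfl | rfl
  · rw [show s - y * s = s * (1 - y) by ring, show s + y * s = s * (1 + y) by ring, e1, e2]
    exact ⟨max_eq_right hle, min_eq_left hle⟩
  · rw [show s - -(y * s) = s * (1 + y) by ring, show s + -(y * s) = s * (1 - y) by ring, e1, e2]
    exact ⟨max_eq_left hle, min_eq_right hle⟩

theorem Gamma_natCast_add_one_add {a : ℝ} (ha : -1 < a) (r : ℕ) :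
    Real.Gamma (r + 1 + a) = (∏ i ∈ range r, ((i : ℝ) + 1 + a)) * Real.Gamma (1 + a) := by
  induction r with
  | zero => simp
  | succ r ih =>
    have h0 : (0 : ℝ) ≤ r := r.cast_nonneg
    rw [prod_range_succ, mul_right_comm, ← ih]
    push_cast
    rw [show (r : ℝ) + 1 + 1 + a = (r + 1 + a) + 1 by ring, Real.Gamma_add_one (by linarith), mul_comm]

theorem factorial_div_prod_eq_Gamma {n : ℕ} (hn : 2 ≤ n) (r : ℕ) :
    (r.factorial : ℝ) / ∏ i ∈ range r, ((i : ℝ) + 1 - 1 / n)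
      = Real.Gamma (1 - 1 / (n : ℝ)) * r.factorial / Real.Gamma ((r : ℝ) + 1 - 1 / (n : ℝ)) := by
  have hn' : (2 : ℝ) ≤ n := by exact_mod_cast hn
  have h1 : 1 / (n : ℝ) < 1 := by rw [div_lt_one (by linarith)]; linarith
  have h := Gamma_natCast_add_one_add (a := -(1 / (n : ℝ))) (by linarith) r
  simp only [← sub_eq_add_neg] at h
  have hG : Real.Gamma (1 - 1 / (n : ℝ)) ≠ 0 := (Real.Gamma_pos_of_pos (by linarith)).ne'
  have hP : ∏ i ∈ range r, ((i : ℝ) + 1 - 1 / n) ≠ 0 :=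
    prod_ne_zero_iff.2 fun i _ => natCast_add_one_sub_ne_zero hn i
  rw [h, div_eq_div_iff hP (mul_ne_zero hP hG)]
  ring

theorem prod_div_factorial_eq_Gamma {n : ℕ} (hn : 2 ≤ n) (r : ℕ) :
    (∏ i ∈ range r, ((i : ℝ) + 1 + 1 / n)) / r.factorial
      = n * Real.Gamma ((r : ℝ) + 1 + 1 / (n : ℝ)) / (Real.Gamma (1 / (n : ℝ)) * r.factorial) := by
  have hn' : (2 : ℝ) ≤ n := by exact_mod_cast hn
  have h1 : 0 < 1 / (n : ℝ) := by positivity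
  have h := Gamma_natCast_add_one_add (a := 1 / (n : ℝ)) (by linarith) r
  have hG : Real.Gamma (1 / (n : ℝ)) ≠ 0 := (Real.Gamma_pos_of_pos h1).ne'
  have hf : (r.factorial : ℝ) ≠ 0 := by exact_mod_cast r.factorial_ne_zero
  rw [h, add_comm 1 (1 / (n : ℝ)), Real.Gamma_add_one h1.ne']
  generalize ∏ i ∈ range r, ((i : ℝ) + 1 + 1 / n) = G
  field_simp

theorem norm_hypForm_eq {n : ℕ} (hn : 2 ≤ n) (r : ℕ) (u v : ℂ) :
    ‖hypForm n r u v‖ = Real.Gamma (1 - 1 / (n : ℝ)) * r.factorial /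
      Real.Gamma ((r : ℝ) + 1 - 1 / (n : ℝ)) * ‖jacobiForm (((1 / n : ℝ)) : ℂ) r u v‖ := by
  have hn' : (2 : ℝ) ≤ n := by exact_mod_cast hn
  have h1 : 1 / (n : ℝ) < 1 := by rw [div_lt_one (by linarith)]; linarith
  rw [hypForm_eq_jacobiForm hn, norm_mul, ← factorial_div_prod_eq_Gamma hn]
  congr 1
  · have : (r.factorial : ℂ) / ∏ i ∈ range r, ((i : ℂ) + 1 - 1 / n)
        = (((r.factorial : ℝ) / ∏ i ∈ range r, ((i : ℝ) + 1 - 1 / n) : ℝ) : ℂ) := by push_cast; rfl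
    rw [this, Complex.norm_real, Real.norm_of_nonneg]
    refine div_nonneg (Nat.cast_nonneg _) (prod_nonneg fun i _ => ?_)
    have : (0 : ℝ) ≤ i := i.cast_nonneg
    linarith
  · push_cast; rfl

theorem norm_hypForm_sub_mul_hypForm {n : ℕ} (hn : 2 ≤ n) (r : ℕ) {U Z ω : ℂ} (hU : U ≠ 0)
    {b : ℝ} (hb : ‖(r.factorial : ℂ) ^ 2 * (ω * jacobiSum (((1 / n : ℝ)) : ℂ) r 1 (Z / U)
      - jacobiSum (((1 / n : ℝ)) : ℂ) r (Z / U) 1)‖ ≤ b) :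
    ‖hypForm n r Z U - ω * hypForm n r U Z‖ ≤ n * Real.Gamma ((r : ℝ) + 1 + 1 / (n : ℝ)) /
      (Real.Gamma (1 / (n : ℝ)) * r.factorial) * (‖U‖ ^ r * b) := by
  have hf : (r.factorial : ℂ) ≠ 0 := by exact_mod_cast r.factorial_ne_zero
  have e1 : hypForm n r Z U = U ^ r * hypForm n r (Z / U) 1 := by
    rw [← hypForm_mul, mul_one, mul_div_cancel₀ _ hU]
  have e2 : hypForm n r U Z = U ^ r * hypForm n r 1 (Z / U) := by
    rw [← hypForm_mul, mul_one, mul_div_cancel₀ _ hU]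
  have e3 : hypForm n r Z U - ω * hypForm n r U Z
      = -(((((∏ i ∈ range r, ((i : ℝ) + 1 + 1 / n)) / r.factorial : ℝ) : ℂ)) * (U ^ r *
        ((r.factorial : ℂ) ^ 2 * (ω * jacobiSum (((1 / n : ℝ)) : ℂ) r 1 (Z / U)
      - jacobiSum (((1 / n : ℝ)) : ℂ) r (Z / U) 1)))) := by
    rw [e1, e2, hypForm_eq_jacobiSum hn, hypForm_eq_jacobiSum hn]
    push_cast
    field_simp
    ring
  rw [e3, norm_neg, norm_mul, norm_mul, norm_pow, Complex.norm_real, Real.norm_of_nonneg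
    (by positivity), ← prod_div_factorial_eq_Gamma hn]
  gcongr

theorem hypForm_casoratian_ne_zero {n : ℕ} (hn : 2 ≤ n) {u v : ℂ} (huv : u ≠ v) (r : ℕ) :
    hypForm n r u v * hypForm n (r + 1) v u - hypForm n (r + 1) u v * hypForm n r v u ≠ 0 := by
  have hP : ∀ r : ℕ, (r.factorial : ℂ) / ∏ i ∈ range r, ((i : ℂ) + 1 - 1 / n) ≠ 0 := fun r =>
    div_ne_zero (by exact_mod_cast r.factorial_ne_zero)
      (prod_ne_zero_iff.2 fun i _ => natCast_add_one_sub_ne_zero hn i)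
  have hn0 : (1 / (n : ℂ)) ≠ 0 := by
    have : (n : ℂ) ≠ 0 := by exact_mod_cast (by omega : n ≠ 0)
    exact one_div_ne_zero this
  have h := jacobiForm_casoratian_ne_zero (natCast_add_one_add_ne_zero (F := ℂ) hn)
    (natCast_add_one_sub_ne_zero hn) hn0 huv r
  simp only [hypForm_eq_jacobiForm hn]
  intro h0
  apply mul_ne_zero (mul_ne_zero (hP r) (hP (r + 1))) h
  linear_combination h0

/-- Size of the forms and of the remainder when `‖W‖ = 1`. Here `s` and `t` are any square roots of
`U` and `Z`. -/
theorem norm_hypForm_bounds_of_norm_eq {n : ℕ} (hn : 2 ≤ n) {U Z s t : ℂ} (hU : U ≠ 0)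
    (hW : ‖Z / U‖ = 1) (hs : s ^ 2 = U) (ht : t ^ 2 = Z) (r : ℕ) :
    ‖hypForm n r Z U‖ ≤ Real.Gamma (1 - 1 / (n : ℝ)) * r.factorial /
        Real.Gamma ((r : ℝ) + 1 - 1 / (n : ℝ)) * (max ‖s - t‖ ‖s + t‖ ^ 2) ^ r ∧
    ‖hypForm n r U Z‖ ≤ Real.Gamma (1 - 1 / (n : ℝ)) * r.factorial /
        Real.Gamma ((r : ℝ) + 1 - 1 / (n : ℝ)) * (max ‖s - t‖ ‖s + t‖ ^ 2) ^ r ∧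
    ‖hypForm n r Z U - nthRoot n (Z / U) * hypForm n r U Z‖
      ≤ n * Real.Gamma ((r : ℝ) + 1 + 1 / (n : ℝ)) / (Real.Gamma (1 / (n : ℝ)) * r.factorial) *
        (2 * ‖1 - nthRoot n (Z / U)‖ * (min ‖s - t‖ ‖s + t‖ ^ 2) ^ r) := by
  have hn' : (2 : ℝ) ≤ n := by exact_mod_cast hn
  have ha₁ : 1 / (n : ℝ) < 1 := by rw [div_lt_one (by linarith)]; linarith
  have ha₀ : 0 < 1 / (n : ℝ) := by positivity
  have hZU : ‖Z‖ = ‖U‖ := by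
    rwa [norm_div, div_eq_one_iff_eq (norm_ne_zero_iff.2 hU)] at hW
  obtain ⟨hmax, hmin⟩ := max_min_sq_of_norm_eq (s := s) (t := t) (ρ := ‖U‖) (by rw [hs])
    (by rw [ht, hZU])
  rw [hs, ht] at hmax hmin
  rw [hmax, hmin]
  have hg : 0 ≤ Real.Gamma (1 - 1 / (n : ℝ)) * r.factorial /
        Real.Gamma ((r : ℝ) + 1 - 1 / (n : ℝ)) := by
    have : (0 : ℝ) ≤ r := r.cast_nonneg
    exact div_nonneg (mul_nonneg (Real.Gamma_pos_of_pos (by linarith)).le (Nat.cast_nonneg _))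
      (Real.Gamma_pos_of_pos (by linarith)).le
  refine ⟨?_, ?_, ?_⟩
  · rw [norm_hypForm_eq hn, add_comm U Z]
    exact mul_le_mul_of_nonneg_left (norm_jacobiForm_le_of_norm_eq ha₀ ha₁ hZU rfl r) hg
  · rw [norm_hypForm_eq hn]
    exact mul_le_mul_of_nonneg_left (norm_jacobiForm_le_of_norm_eq ha₀ ha₁ rfl hZU r) hg
  · have h := norm_remainder_le_of_norm_eq_one ha₀ ha₁ hW r
    have hω : (Z / U) ^ (((1 / n : ℝ)) : ℂ) = nthRoot n (Z / U) := by rw [nthRoot]; push_cast; rfl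
    rw [hω] at h
    refine (norm_hypForm_sub_mul_hypForm hn r hU h).trans (le_of_eq ?_)
    have e : ‖U‖ * (2 - ‖1 + Z / U‖) = 2 * ‖U‖ - ‖U + Z‖ := by
      have : U + Z = U * (1 + Z / U) := by field_simp
      rw [this, norm_mul]; ring
    rw [← e, mul_pow]
    ring

/-- Size of the forms and of the remainder when `W = y ^ 2` with `1 / 18 ≤ y < 1`. For `n ≥ 3` the
lower bound on `y` is the condition of `jacobiForm_sq_le` for the second form. -/
theorem norm_hypForm_bounds_of_real {n : ℕ} (hn : 3 ≤ n) {U Z s t : ℂ} {y : ℝ} (hU : U ≠ 0)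
    (hy₀ : 1 / 18 ≤ y) (hy₁ : y < 1) (hW : Z = (y : ℂ) ^ 2 * U)
    (hs : s ^ 2 = U) (ht : t ^ 2 = Z) (r : ℕ) :
    ‖hypForm n r Z U‖ ≤ Real.Gamma (1 - 1 / (n : ℝ)) * r.factorial /
        Real.Gamma ((r : ℝ) + 1 - 1 / (n : ℝ)) * (3 * (max ‖s - t‖ ‖s + t‖ ^ 2) ^ r) ∧
    ‖hypForm n r U Z‖ ≤ Real.Gamma (1 - 1 / (n : ℝ)) * r.factorial /
        Real.Gamma ((r : ℝ) + 1 - 1 / (n : ℝ)) * (3 * (max ‖s - t‖ ‖s + t‖ ^ 2) ^ r) ∧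
    ‖hypForm n r Z U - nthRoot n (Z / U) * hypForm n r U Z‖
      ≤ n * Real.Gamma ((r : ℝ) + 1 + 1 / (n : ℝ)) / (Real.Gamma (1 / (n : ℝ)) * r.factorial) *
        (‖1 - nthRoot n (Z / U)‖ * (min ‖s - t‖ ‖s + t‖ ^ 2) ^ r) := by
  have hn' : (3 : ℝ) ≤ n := by exact_mod_cast hn
  have ha₃ : 1 / (n : ℝ) ≤ 1 / 3 := by gcongr
  have ha₁ : 1 / (n : ℝ) < 1 := by linarith
  have ha₀ : 0 < 1 / (n : ℝ) := by positivity
  have hy : 0 < y := by linarith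
  obtain ⟨hmax, hmin⟩ := max_min_of_sq_eq_mul hy.le hy₁.le (by rw [ht, hs, hW] :
    t ^ 2 = (y : ℂ) ^ 2 * s ^ 2)
  have hM : (max ‖s - t‖ ‖s + t‖ ^ 2) ^ r = ‖U‖ ^ r * (1 + y) ^ (2 * r) := by
    rw [hmax, mul_pow, ← norm_pow, hs, mul_pow, ← pow_mul]
  have hm : (min ‖s - t‖ ‖s + t‖ ^ 2) ^ r = ‖U‖ ^ r * ((1 - y) ^ 2) ^ r := by
    rw [hmin, mul_pow, ← norm_pow, hs, mul_pow]
  rw [hM, hm]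
  have hg : 0 ≤ Real.Gamma (1 - 1 / (n : ℝ)) * r.factorial /
        Real.Gamma ((r : ℝ) + 1 - 1 / (n : ℝ)) := by
    have : (0 : ℝ) ≤ r := r.cast_nonneg
    exact div_nonneg (mul_nonneg (Real.Gamma_pos_of_pos (by linarith)).le (Nat.cast_nonneg _))
      (Real.Gamma_pos_of_pos (by linarith)).le
  have hcast : ∀ p q : ℝ, 0 ≤ p → 0 < q → (1 / n : ℝ) * p ≤ 6 * q →
      ‖jacobiForm (((1 / n : ℝ)) : ℂ) r ((p : ℂ) ^ 2) ((q : ℂ) ^ 2)‖ ≤ 3 * (p + q) ^ (2 * r) := by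
    intro p q hp hq hpq
    have h := map_jacobiForm Complex.ofRealHom (1 / n : ℝ) r (p ^ 2) (q ^ 2)
    simp only [Complex.ofRealHom_eq_coe, Complex.ofReal_pow] at h
    rw [← h, Complex.norm_real, Real.norm_of_nonneg
      (jacobiForm_nonneg ha₀.le ha₁ (by positivity) (by positivity) r)]
    exact jacobiForm_sq_le ha₀.le ha₁ hp hq hpq r
  have hZU : Z / U = (y : ℂ) ^ 2 := by rw [hW]; field_simp
  refine ⟨?_, ?_, ?_⟩
  · rw [show Z = U * (y : ℂ) ^ 2 by rw [hW]; ring]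
    nth_rewrite 2 [← mul_one U]
    rw [hypForm_mul, norm_mul, norm_pow, norm_hypForm_eq (by omega)]
    have h := hcast y 1 hy.le one_pos (by nlinarith)
    rw [Complex.ofReal_one, one_pow] at h
    calc _ ≤ ‖U‖ ^ r * (Real.Gamma (1 - 1 / (n : ℝ)) * r.factorial /
          Real.Gamma ((r : ℝ) + 1 - 1 / (n : ℝ)) * (3 * (y + 1) ^ (2 * r))) := by gcongr
      _ = _ := by rw [add_comm y 1]; ring
  · rw [show Z = U * (y : ℂ) ^ 2 by rw [hW]; ring]
    nth_rewrite 1 [← mul_one U]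
    rw [hypForm_mul, norm_mul, norm_pow, norm_hypForm_eq (by omega)]
    have h := hcast 1 y zero_le_one hy (by linarith)
    rw [Complex.ofReal_one, one_pow] at h
    calc _ ≤ ‖U‖ ^ r * (Real.Gamma (1 - 1 / (n : ℝ)) * r.factorial /
          Real.Gamma ((r : ℝ) + 1 - 1 / (n : ℝ)) * (3 * (1 + y) ^ (2 * r))) := by gcongr
      _ = _ := by ring
  · have h := norm_remainder_le_of_real ha₀ ha₁ (t := y ^ 2) (by positivity)
      (by nlinarith) r
    rw [Real.sqrt_sq hy.le, Complex.ofReal_pow, ← hZU] at h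
    have hω : (Z / U) ^ (((1 / n : ℝ)) : ℂ) = nthRoot n (Z / U) := by rw [nthRoot]; push_cast; rfl
    rw [hω] at h
    refine (norm_hypForm_sub_mul_hypForm (by omega) r hU h).trans (le_of_eq ?_)
    ring

theorem one_le_of_forall_le_mul_pow {C x : ℝ} (hx : 0 ≤ x)
    (h : ∀ r : ℕ, 1 ≤ C * x ^ r) : 1 ≤ x := by
  by_contra hlt
  push Not at hlt
  have t : Filter.Tendsto (fun r => C * x ^ r) Filter.atTop (nhds 0) := by
    simpa using (tendsto_pow_atTop_nhds_zero_of_lt_one hx hlt).const_mul C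
  obtain ⟨r, hr⟩ := (t.eventually_lt_const one_pos).exists
  linarith [h r]

/-- A geometric bound for `D_{n,r} / N_{d,n,r}` has ratio at least `6 / (5 d)`, by the growth of
`D_{n,r}` and `N_{d,n,r} ≤ d ^ r`. -/
theorem six_fifths_le_mul_of_denomX_div_numerX_le {n d : ℕ} (hn : 3 ≤ n) (hd : 0 < d) {C x : ℝ}
    (hx : 0 < x)
    (h : ∀ r, (denomX n r : ℝ) / numerX d n r ≤ C * x ^ r) : 6 / 5 ≤ x * d := by
  have hd' : (0 : ℝ) < d := by exact_mod_cast hd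
  have key : ∀ s : ℕ, 1 ≤ C * ((x * d / (6 / 5)) ^ 9) ^ s := by
    intro s
    have hN : (0 : ℝ) < numerX d n (9 * s) := by exact_mod_cast numerX_pos hd n (9 * s)
    have hNd : (numerX d n (9 * s) : ℝ) ≤ (d : ℝ) ^ (9 * s) := by
      exact_mod_cast Nat.le_of_dvd (by positivity) (numerX_dvd_pow hd n (9 * s))
    have h1 := h (9 * s)
    rw [div_le_iff₀ hN] at h1
    have h2 := pow_le_denomX hn s
    have hD : (0 : ℝ) < denomX n (9 * s) := by exact_mod_cast (denomX_spec n (9 * s)).1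
    have hC : 0 ≤ C * x ^ (9 * s) := le_trans (by positivity) (h (9 * s))
    rw [← pow_mul, div_pow, mul_pow, ← mul_div_assoc, le_div_iff₀ (by positivity), one_mul]
    calc _ ≤ _ := h2
      _ ≤ C * x ^ (9 * s) * numerX d n (9 * s) := h1
      _ ≤ C * x ^ (9 * s) * (d : ℝ) ^ (9 * s) := by gcongr
      _ = _ := by ring
  have h1 := one_le_of_forall_le_mul_pow (by positivity) key
  have h2 : 1 ≤ x * d / (6 / 5) := by
    by_contra hlt
    push Not at hlt
    exact absurd h1 (not_le.2 (pow_lt_one₀ (by positivity) hlt (by norm_num)))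
  rwa [le_div_iff₀ (by norm_num), one_mul] at h2

theorem calN_pos (d n : ℕ) : 0 < calN d n :=
  prod_pos fun p hp => Real.rpow_pos_of_pos (by
    exact_mod_cast (Nat.prime_of_mem_primeFactors hp).pos) _

/-! ### Approximations to `𝒜(x)` -/

/-- The gap principle for the linear forms `q P_r - p R_r` built from the approximations
`P_r / R_r`. -/
theorem one_le_norm_linearForm {K : IntermediateField ℚ ℂ} (hK : IsRatOrImagQuadratic K)
    {n d r : ℕ} (hd : 0 < d) {β₁ β₂ x U Z g η p q : ℂ} (hg : g ≠ 0) (hU : U ≠ 0) (hZ : Z ≠ 0)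
    (hβ₁ : IsIntegral ℤ β₁) (hβ₂ : IsIntegral ℤ β₂) (hx : IsIntegral ℤ x)
    (hUg : IsIntegral ℤ (U / g)) (hZg : IsIntegral ℤ (Z / g))
    (hdg : IsIntegral ℤ ((U - Z) / ((d : ℂ) * g)))
    (hη : IsIntegral ℤ η) (hηK : η / g ^ r ∈ K) (hp : IsIntegral ℤ p) (hq : IsIntegral ℤ q)
    (hsq : ((q * β₁ - p) * (x - β₂) * hypForm n r Z U
      - (q * β₂ - p) * (x - β₁) * hypForm n r U Z) ^ 2 ∈ K)
    (hne : (denomX n r : ℂ) / numerX d n r * (η / g ^ r) *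
      ((q * β₁ - p) * (x - β₂) * hypForm n r Z U
        - (q * β₂ - p) * (x - β₁) * hypForm n r U Z) ≠ 0) :
    1 ≤ ‖(denomX n r : ℂ) / numerX d n r * (η / g ^ r) *
      ((q * β₁ - p) * (x - β₂) * hypForm n r Z U
        - (q * β₂ - p) * (x - β₁) * hypForm n r U Z)‖ := by
  have hd0 : (d : ℂ) ≠ 0 := by exact_mod_cast hd.ne'
  refine one_le_norm_of_sq_mem hK ?_ ?_ hne
  · have hZU : IsIntegral ℤ ((denomX n r : ℂ) / numerX d n r * hypForm n r (Z / g) (U / g)) := by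
      have h := isIntegral_denomX_div_numerX_mul_hypForm hd n r (div_ne_zero hU hg) hUg hdg
      rwa [show U / g - d * ((U - Z) / (d * g)) = Z / g by field_simp; ring] at h
    have hUZ : IsIntegral ℤ ((denomX n r : ℂ) / numerX d n r * hypForm n r (U / g) (Z / g)) := by
      have h := isIntegral_denomX_div_numerX_mul_hypForm hd n r (div_ne_zero hZ hg) hZg hdg.neg
      rwa [show Z / g - d * -((U - Z) / (d * g)) = U / g by field_simp; ring] at h
    have hhom : ∀ u v : ℂ, hypForm n r u v = g ^ r * hypForm n r (u / g) (v / g) := fun u v => by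
      rw [← hypForm_mul, mul_div_cancel₀ _ hg, mul_div_cancel₀ _ hg]
    have e : (denomX n r : ℂ) / numerX d n r * (η / g ^ r) *
      ((q * β₁ - p) * (x - β₂) * hypForm n r Z U
        - (q * β₂ - p) * (x - β₁) * hypForm n r U Z)
      = η * ((q * β₁ - p) * (x - β₂) *
          ((denomX n r : ℂ) / numerX d n r * hypForm n r (Z / g) (U / g))
        - (q * β₂ - p) * (x - β₁) *
          ((denomX n r : ℂ) / numerX d n r * hypForm n r (U / g) (Z / g))) := by
      rw [hhom Z U, hhom U Z]
      have hgr : g ^ r ≠ 0 := pow_ne_zero _ hg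
      generalize (denomX n r : ℂ) / numerX d n r = D
      field_simp
    rw [e]
    exact hη.mul ((((hq.mul hβ₁).sub hp).mul (hx.sub hβ₂)).mul hZU |>.sub
      ((((hq.mul hβ₂).sub hp).mul (hx.sub hβ₁)).mul hUZ))
  · rw [mul_pow]
    refine K.mul_mem (pow_mem (K.mul_mem (K.div_mem ?_ ?_) hηK) 2) hsq
    · exact natCast_mem K _
    · exact natCast_mem K _

/-- The algebraic integers `h_r ((U - Z) / (d g)) ^ r` have norm at least `1` for all `r`, and the
`h_r` are bounded. -/
theorem mul_norm_le_norm_sub {K : IntermediateField ℚ ℂ} (hK : IsRatOrImagQuadratic K)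
    {d : ℕ} (hd : 0 < d) {U Z g : ℂ} (hg : g ≠ 0) (hUZ : U ≠ Z) (hsq : (U - Z) ^ 2 ∈ K)
    (hdg : IsIntegral ℤ ((U - Z) / ((d : ℂ) * g)))
    {hseq : ℕ → ℂ} {h : ℝ} (hseq_spec : ∀ r : ℕ, hseq r ≠ 0 ∧ IsIntegral ℤ (hseq r) ∧
      hseq r / g ^ r ∈ K ∧ ‖hseq r‖ ≤ h) :
    d * ‖g‖ ≤ ‖U - Z‖ := by
  have hd0 : (d : ℂ) ≠ 0 := by exact_mod_cast hd.ne'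
  have hd' : (0 : ℝ) < d := by exact_mod_cast hd
  have hg' : 0 < ‖g‖ := norm_pos_iff.2 hg
  have key : ∀ r : ℕ, 1 ≤ h * (‖U - Z‖ / (d * ‖g‖)) ^ r := by
    intro r
    obtain ⟨h0, hi, hmem, hle⟩ := hseq_spec r
    have h1 : 1 ≤ ‖hseq r * ((U - Z) / ((d : ℂ) * g)) ^ r‖ := by
      refine one_le_norm_of_sq_mem hK (hi.mul (hdg.pow r)) ?_ (mul_ne_zero h0 (pow_ne_zero _
        (div_ne_zero (sub_ne_zero.2 hUZ) (mul_ne_zero hd0 hg))))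
      have e : (hseq r * ((U - Z) / ((d : ℂ) * g)) ^ r) ^ 2
          = (hseq r / g ^ r) ^ 2 * ((U - Z) ^ 2) ^ r / ((d : ℂ) ^ r) ^ 2 := by
        rw [div_pow, mul_pow (d : ℂ) g r]
        field_simp
        rw [← pow_mul, ← pow_mul, mul_comm]
      rw [e]
      exact K.div_mem (K.mul_mem (pow_mem hmem 2) (pow_mem hsq r))
        (pow_mem (pow_mem (natCast_mem K _) r) 2)
    rw [norm_mul, norm_pow, norm_div, norm_mul, Complex.norm_natCast] at h1
    refine h1.trans ?_
    gcongr
  have := one_le_of_forall_le_mul_pow (by positivity) key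
  rwa [le_div_iff₀ (by positivity), one_mul] at this

/-- The irrationality measure from size bounds with constants `kA` (for the forms, in the
normalization `G₁`) and `kR` (for the remainder, in the normalization `G₂`). The constants `4` and
`5` of the measure leave room for every pair with `kA < 4 (1 - kR / 5)`. -/
theorem nonzero_and_lt_norm_sub_div {K : IntermediateField ℚ ℂ} (hK : IsRatOrImagQuadratic K)
    {β₁ β₂ x U Z ω A g : ℂ} {n d : ℕ} (hn : 3 ≤ n) (hd : 0 < d)
    (hβ : β₁ ≠ β₂) (hxβ₁ : x - β₁ ≠ 0) (hxβ₂ : x - β₂ ≠ 0) (hU0 : U ≠ 0) (hZ0 : Z ≠ 0)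
    (hUZ : U ≠ Z)
    (hβ₁ : IsIntegral ℤ β₁) (hβ₂ : IsIntegral ℤ β₂) (hx : IsIntegral ℤ x)
    (hsq : ∀ p q : ℂ, p ∈ K → q ∈ K → ∀ r : ℕ,
      ((q * β₁ - p) * (x - β₂) * hypForm n r Z U
        - (q * β₂ - p) * (x - β₁) * hypForm n r U Z) ^ 2 ∈ K)
    (hA : A = (β₁ * (x - β₂) * ω - β₂ * (x - β₁)) / ((x - β₂) * ω - (x - β₁)))
    (hg : g ≠ 0) (hUg : IsIntegral ℤ (U / g)) (hZg : IsIntegral ℤ (Z / g))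
    (hdg : IsIntegral ℤ ((U - Z) / ((d : ℂ) * g)))
    {hseq : ℕ → ℂ} {h : ℝ} (hh : 0 < h) (hseq_spec : ∀ r : ℕ, hseq r ≠ 0 ∧ IsIntegral ℤ (hseq r) ∧
      hseq r / g ^ r ∈ K ∧ ‖hseq r‖ ≤ h)
    {C D E Q M m T kA kR : ℝ} (hC : 0 < C) (hD : 0 < D) (hM : 0 < M) (hm : 0 < m) (hT : 1 ≤ T)
    {G₁ G₂ : ℕ → ℝ}
    (hG₁ : ∀ r, G₁ r * ((denomX n r : ℝ) / numerX d n r) ≤ C * D ^ r)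
    (hG₂ : ∀ r, G₂ r * ((denomX n r : ℝ) / numerX d n r) ≤ C * D ^ r)
    (hkA : 0 < kA) (hkR : 0 ≤ kR) (hkk : kA < 4 * (1 - kR / 5))
    (hb₁ : ∀ r, ‖hypForm n r Z U‖ ≤ G₁ r * (kA * M ^ r))
    (hb₂ : ∀ r, ‖hypForm n r U Z‖ ≤ G₁ r * (kA * M ^ r))
    (hb₃ : ∀ r, ‖hypForm n r Z U - ω * hypForm n r U Z‖ ≤ G₂ r * (kR * ‖1 - ω‖ * m ^ r))
    (hE : E = ‖g‖ / D * m⁻¹) (hQ : Q = D / ‖g‖ * M) (hE1 : 1 < E) :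
    (x - β₂) * ω - (x - β₁) ≠ 0 ∧
    ∀ p q : ℂ, p ∈ K → q ∈ K → IsIntegral ℤ p → IsIntegral ℤ q → q ≠ 0 →
      1 / (4 * h * T * (‖x - β₁‖ + ‖x - β₂‖) * C * Q *
        max 1 (5 * h * T * ‖1 - ω‖ * ‖x - β₂‖ * ‖A - β₁‖ * C * E) ^ (Real.log Q / Real.log E)
          * ‖q‖ ^ (Real.log Q / Real.log E + 1)) < ‖A - p / q‖ := by
  have hg' : 0 < ‖g‖ := norm_pos_iff.2 hg
  have hE0 : 0 < E := by linarith
  set c : ℕ → ℂ := fun r => (denomX n r : ℂ) / numerX d n r * (hseq r / g ^ r) with hc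
  have hc0 : ∀ r, c r ≠ 0 := fun r =>
    mul_ne_zero (div_ne_zero (by exact_mod_cast (denomX_spec n r).1.ne')
      (by exact_mod_cast (numerX_pos hd n r).ne')) (div_ne_zero (hseq_spec r).1 (pow_ne_zero _ hg))
  have hcn : ∀ r (γ : ℝ), 0 ≤ γ → γ * ((denomX n r : ℝ) / numerX d n r) ≤ C * D ^ r →
      ‖c r‖ * γ ≤ h * C * (D / ‖g‖) ^ r := by
    intro r γ hγ hle
    simp only [hc]
    rw [norm_mul, norm_div, norm_div, norm_pow, Complex.norm_natCast, Complex.norm_natCast]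
    calc (denomX n r : ℝ) / numerX d n r * (‖hseq r‖ / ‖g‖ ^ r) * γ
        = γ * ((denomX n r : ℝ) / numerX d n r) * (‖hseq r‖ / ‖g‖ ^ r) := by ring
      _ ≤ C * D ^ r * (h / ‖g‖ ^ r) := by
          gcongr
          exact (hseq_spec r).2.2.2
      _ = _ := by rw [div_pow]; ring
  have hG₁0 : ∀ r, 0 ≤ G₁ r := fun r => by
    by_contra hneg
    push Not at hneg
    have h1 := (norm_nonneg _).trans (hb₁ r)
    have h2 : 0 < kA * M ^ r := by positivity
    nlinarith
  have hdetAB : ∀ r, hypForm n r Z U * hypForm n (r + 1) U Z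
      - hypForm n (r + 1) Z U * hypForm n r U Z ≠ 0 := fun r =>
    hypForm_casoratian_ne_zero (by omega) hUZ.symm r
  -- the remainder decays like `E ^ (-r)`
  have hrem : ∀ r, ‖c r‖ * ‖hypForm n r Z U - ω * hypForm n r U Z‖
      ≤ kR * h * ‖1 - ω‖ * C / E ^ r := by
    intro r
    have hE' : h * C * (D / ‖g‖) ^ r * (kR * ‖1 - ω‖ * m ^ r) = kR * h * ‖1 - ω‖ * C / E ^ r := by
      rw [hE, mul_pow, div_pow, div_pow, inv_pow]
      field_simp
    rw [← hE']
    rcases le_or_gt 0 (G₂ r) with hγ | hγ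
    · calc _ ≤ ‖c r‖ * (G₂ r * (kR * ‖1 - ω‖ * m ^ r)) := by gcongr; exact hb₃ r
        _ = ‖c r‖ * G₂ r * (kR * ‖1 - ω‖ * m ^ r) := by ring
        _ ≤ _ := mul_le_mul_of_nonneg_right (hcn r _ hγ (hG₂ r)) (by positivity)
    · have h1 : G₂ r * (kR * ‖1 - ω‖ * m ^ r) ≤ 0 :=
        mul_nonpos_of_nonpos_of_nonneg hγ.le (by positivity)
      have h2 : ‖hypForm n r Z U - ω * hypForm n r U Z‖ = 0 :=
        le_antisymm ((hb₃ r).trans h1) (norm_nonneg _)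
      rw [h2, mul_zero]
      positivity
  have hgap : ∀ p q : ℂ, p ∈ K → q ∈ K → IsIntegral ℤ p → IsIntegral ℤ q → ∀ r,
      c r * ((q * β₁ - p) * (x - β₂) * hypForm n r Z U
        - (q * β₂ - p) * (x - β₁) * hypForm n r U Z) ≠ 0 →
      1 ≤ ‖c r * ((q * β₁ - p) * (x - β₂) * hypForm n r Z U
        - (q * β₂ - p) * (x - β₁) * hypForm n r U Z)‖ := fun p q hp hq hpi hqi r hne =>
    one_le_norm_linearForm hK hd hg hU0 hZ0 hβ₁ hβ₂ hx hUg hZg hdg (hseq_spec r).2.1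
      (hseq_spec r).2.2.1 hpi hqi (hsq p q hp hq r) hne
  set R : ℕ → ℂ := fun r => c r * ((x - β₂) * hypForm n r Z U - (x - β₁) * hypForm n r U Z) with hR
  set P : ℕ → ℂ := fun r => c r * (β₁ * (x - β₂) * hypForm n r Z U
    - β₂ * (x - β₁) * hypForm n r U Z) with hP
  have hRgap : ∀ r, R r ≠ 0 → 1 ≤ ‖R r‖ := by
    intro r hne
    have h1 := hgap (-1) 0 (K.neg_mem K.one_mem) K.zero_mem (isIntegral_one.neg) isIntegral_zero r
    have e : c r * ((0 * β₁ - -1) * (x - β₂) * hypForm n r Z U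
        - (0 * β₂ - -1) * (x - β₁) * hypForm n r U Z) = R r := by simp only [hR]; ring
    rw [e] at h1
    exact h1 hne
  have hdetR : ∀ r, P r * R (r + 1) - P (r + 1) * R r ≠ 0 := by
    intro r
    have e : P r * R (r + 1) - P (r + 1) * R r = c r * c (r + 1) * (x - β₂) * (x - β₁) * (β₂ - β₁) *
      (hypForm n r Z U * hypForm n (r + 1) U Z - hypForm n (r + 1) Z U * hypForm n r U Z) := by
      simp only [hP, hR]; ring
    rw [e]
    exact mul_ne_zero (mul_ne_zero (mul_ne_zero (mul_ne_zero (mul_ne_zero (hc0 r) (hc0 (r + 1)))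
      hxβ₂) hxβ₁) (sub_ne_zero.2 hβ.symm)) (hdetAB r)
  -- if the denominator of `A` vanished, then `R r` would itself be a multiple of the remainder,
  -- hence would vanish for all large `r`, against `hdetR`
  have hden : (x - β₂) * ω - (x - β₁) ≠ 0 := by
    intro h0
    have hRr : ∀ r, R r = c r * ((x - β₂) * (hypForm n r Z U - ω * hypForm n r U Z)) := fun r => by
      simp only [hR]
      linear_combination c r * hypForm n r U Z * h0
    have ht : Filter.Tendsto (fun r => ‖x - β₂‖ * (kR * h * ‖1 - ω‖ * C) * E⁻¹ ^ r) Filter.atTop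
        (nhds 0) := by
      simpa using (tendsto_pow_atTop_nhds_zero_of_lt_one (inv_nonneg.2 hE0.le)
        (inv_lt_one_of_one_lt₀ hE1)).const_mul (‖x - β₂‖ * (kR * h * ‖1 - ω‖ * C))
    have hz : ∀ r, ‖x - β₂‖ * (kR * h * ‖1 - ω‖ * C) * E⁻¹ ^ r < 1 → R r = 0 := by
      intro r hr
      by_contra hne
      have h1 := hRgap r hne
      rw [hRr, norm_mul (c r), norm_mul (x - β₂)] at h1
      have h2 : ‖c r‖ * (‖x - β₂‖ * ‖hypForm n r Z U - ω * hypForm n r U Z‖)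
          ≤ ‖x - β₂‖ * (kR * h * ‖1 - ω‖ * C / E ^ r) := by
        rw [mul_left_comm]
        gcongr
        exact hrem r
      rw [inv_pow, ← div_eq_mul_inv, mul_div_assoc] at hr
      linarith
    obtain ⟨r, hr, hr'⟩ := ((ht.eventually_lt_const one_pos).and
      ((Filter.tendsto_add_atTop_nat 1).eventually (ht.eventually_lt_const one_pos))).exists
    apply hdetR r
    rw [hz r hr, hz (r + 1) hr']
    ring
  refine ⟨hden, fun p q hp hq hpi hqi hq0 => ?_⟩
  have hq1 : 1 ≤ ‖q‖ := one_le_norm_of_sq_mem hK hqi (pow_mem hq 2) hq0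
  have hQ0 : 0 < Q := by rw [hQ]; positivity
  have hxx : 0 < ‖x - β₁‖ + ‖x - β₂‖ := add_pos (norm_pos_iff.2 hxβ₁) (norm_pos_iff.2 hxβ₂)
  have hR' : ∀ r, ‖R r‖ ≤ kA * h * (‖x - β₁‖ + ‖x - β₂‖) * C * Q ^ r := by
    intro r
    simp only [hR]
    rw [norm_mul]
    calc _ ≤ ‖c r‖ * (‖x - β₂‖ * (G₁ r * (kA * M ^ r)) + ‖x - β₁‖ * (G₁ r * (kA * M ^ r))) := by
          gcongr
          refine (norm_sub_le _ _).trans ?_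
          rw [norm_mul, norm_mul]
          gcongr
          · exact hb₁ r
          · exact hb₂ r
      _ = ‖c r‖ * G₁ r * ((‖x - β₁‖ + ‖x - β₂‖) * (kA * M ^ r)) := by ring
      _ ≤ h * C * (D / ‖g‖) ^ r * ((‖x - β₁‖ + ‖x - β₂‖) * (kA * M ^ r)) :=
          mul_le_mul_of_nonneg_right (hcn r _ (hG₁0 r) (hG₁ r)) (by positivity)
      _ = _ := by rw [hQ, mul_pow]; ring
  have hP' : ∀ r, ‖R r * A - P r‖
      ≤ (kR * h * ‖1 - ω‖ * ‖x - β₂‖ * ‖A - β₁‖ * C) / E ^ r := by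
    intro r
    have e : R r * A - P r = (x - β₂) * (A - β₁) *
        (c r * (hypForm n r Z U - ω * hypForm n r U Z)) := by
      have h1 : A * ((x - β₂) * ω - (x - β₁)) = β₁ * (x - β₂) * ω - β₂ * (x - β₁) := by
        rw [hA, div_mul_cancel₀ _ hden]
      simp only [hR, hP]
      linear_combination c r * hypForm n r U Z * h1
    rw [e, norm_mul, norm_mul, norm_mul]
    calc _ ≤ ‖x - β₂‖ * ‖A - β₁‖ * (kR * h * ‖1 - ω‖ * C / E ^ r) := by
          gcongr
          exact hrem r
      _ = _ := by ring
  have hgap' : ∀ r, q * P r - p * R r ≠ 0 → 1 ≤ ‖q * P r - p * R r‖ := by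
    intro r hne
    have e : q * P r - p * R r = c r * ((q * β₁ - p) * (x - β₂) * hypForm n r Z U
        - (q * β₂ - p) * (x - β₁) * hypForm n r U Z) := by simp only [hP, hR]; ring
    rw [e] at hne ⊢
    exact hgap p q hp hq hpi hqi r hne
  have hmain := le_mul_norm_sub_div (L := 5 * h * T * ‖1 - ω‖ * ‖x - β₂‖ * ‖A - β₁‖ * C)
    (η := kR / 5) hE1 hQ0 (k := kA * h * (‖x - β₁‖ + ‖x - β₂‖) * C) (by positivity)
    (by positivity) (by
      have : 0 ≤ kR * h * ‖1 - ω‖ * ‖x - β₂‖ * ‖A - β₁‖ * C := by positivity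
      nlinarith) hR' hP' hdetR hRgap hgap' hq1
  have hmax : 0 < max 1 (5 * h * T * ‖1 - ω‖ * ‖x - β₂‖ * ‖A - β₁‖ * C * E) :=
    lt_of_lt_of_le one_pos (le_max_left _ _)
  have hqp : 0 < ‖q‖ := by linarith
  set B := (h * (‖x - β₁‖ + ‖x - β₂‖) * C * Q *
    max 1 (5 * h * T * ‖1 - ω‖ * ‖x - β₂‖ * ‖A - β₁‖ * C * E) ^ (Real.log Q / Real.log E)
      * ‖q‖ ^ (Real.log Q / Real.log E + 1)) with hB
  have hB0 : 0 < B := by positivity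
  have h1 : 1 - kR / 5 ≤ kA * (B * ‖A - p / q‖) := by
    refine hmain.trans (le_of_eq ?_)
    rw [hB]; ring
  have h2 : 1 < 4 * (B * ‖A - p / q‖) := by
    have : kA * 1 < kA * (4 * (B * ‖A - p / q‖)) := by linarith
    exact lt_of_mul_lt_mul_left this hkA.le
  have h3 : 1 < 4 * (B * ‖A - p / q‖) * T := by nlinarith
  rw [div_lt_iff₀ (by positivity)]
  refine h3.trans_le (le_of_eq ?_)
  rw [hB]; ring

theorem one_le_norm_nthRoot_two {K : IntermediateField ℚ ℂ} (hK : IsRatOrImagQuadratic K)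
    {β τ : ℂ} (hτ_one : K = ⊥ ∨ K⟮β⟯ = ⊥ → τ = 1)
    (hτ : ¬ (K = ⊥ ∨ K⟮β⟯ = ⊥) → τ ∈ K ∧ IsIntegral ℤ τ ∧ K⟮β⟯ = K⟮nthRoot 2 τ⟯) :
    1 ≤ ‖nthRoot 2 τ‖ := by
  by_cases hcase : K = ⊥ ∨ K⟮β⟯ = ⊥
  · rw [hτ_one hcase, nthRoot, Complex.one_cpow, norm_one]
  · obtain ⟨hτK, hint, hadj⟩ := hτ hcase
    have hsq := nthRoot_two_sq τ
    refine one_le_norm_of_sq_mem hK (IsIntegral.of_pow two_pos (by rwa [hsq])) (by rwa [hsq]) ?_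
    intro h0
    rw [h0, IntermediateField.adjoin_zero] at hadj
    exact hcase (Or.inr hadj)

end ThueHypergeometric

open ThueHypergeometric in
theorem theorem2p1
    (K : IntermediateField ℚ ℂ) (hK : IsRatOrImagQuadratic K)
    (β₁ β₂ γ₁ γ₂ τ x : ℂ) (n : ℕ) (hn : 3 ≤ n)
    (hβ₁ : IsIntegral ℤ β₁) (hdeg : Module.finrank K K⟮β₁⟯ ≤ 2)
    -- the choice of `τ`
    (hτ_one : K = ⊥ ∨ K⟮β₁⟯ = ⊥ → τ = 1)
    (hτ : ¬ (K = ⊥ ∨ K⟮β₁⟯ = ⊥) →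
      τ ∈ K ∧ IsIntegral ℤ τ ∧ K⟮β₁⟯ = K⟮nthRoot 2 τ⟯)
    -- the choice of `β₂`, `γ₁`, `γ₂`
    (h_deg_one : β₁ ∈ K →
      β₂ ∈ K ∧ γ₁ ∈ K ∧ γ₂ ∈ K ∧ γ₁ ≠ 0 ∧ γ₂ ≠ 0 ∧ β₂ ≠ β₁ ∧ IsIntegral ℤ β₂)
    (h_deg_two : Module.finrank K K⟮β₁⟯ = 2 →
      ∃ σ : K⟮β₁⟯ ≃ₐ[K] K⟮β₁⟯, σ ≠ AlgEquiv.refl ∧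
        β₂ = (σ (IntermediateField.AdjoinSimple.gen K β₁) : ℂ) ∧
        ∃ γ : K⟮β₁⟯, γ₁ = (γ : ℂ) ∧ γ₂ = (σ γ : ℂ))
    (hxK : x ∈ K) (hx : IsIntegral ℤ x)
    -- `U(x)`, `Z(x)`, `W(x)`, the root `W(x)^{1/n}` and `𝒜(x)`
    (U Z W ω A : ℂ)
    (hU : U = -γ₂ * (x - β₂) ^ n) (hZ : Z = γ₁ * (x - β₁) ^ n) (hW : W = Z / U)
    (hω : ω = nthRoot n W)
    (hA : A = (β₁ * (x - β₂) * ω - β₂ * (x - β₁)) / ((x - β₂) * ω - (x - β₁)))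
    -- `g`, the `h_r` and `h`
    (g : ℂ) (hg : g ≠ 0) (hg_alg : IsAlgebraic ℚ g)
    (hUg : IsIntegral ℤ (U / g)) (hZg : IsIntegral ℤ (Z / g))
    (hseq : ℕ → ℂ) (h : ℝ) (hh : 0 < h)
    (hseq_spec : ∀ r : ℕ, hseq r ≠ 0 ∧ IsIntegral ℤ (hseq r) ∧
      hseq r / g ^ r ∈ K ∧ ‖hseq r‖ ≤ h)
    -- `d`, `𝒞ₙ` and `𝒟ₙ`
    (d : ℕ) (hd : IsGreatest {k : ℕ | 0 < k ∧ IsIntegral ℤ ((U - Z) / ((k : ℂ) * g))} d)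
    (Cn Dn : ℝ) (hCn : 0 < Cn) (hDn : 0 < Dn)
    (hCD : ∀ r : ℕ,
      max 1 (max
          (Real.Gamma (1 - 1 / (n : ℝ)) * (r.factorial : ℝ)
            / Real.Gamma ((r : ℝ) + 1 - 1 / (n : ℝ)))
          ((n : ℝ) * Real.Gamma ((r : ℝ) + 1 + 1 / (n : ℝ))
            / (Real.Gamma (1 / (n : ℝ)) * (r.factorial : ℝ))))
        * ((denomX n r : ℝ) / (numerX d n r : ℝ))
      < Cn * (Dn / calN d n) ^ r)
    -- `E`, `Q`, `κ` and `c`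
    (E Q κ c : ℝ)
    (hE : E = ‖g‖ * calN d n / Dn *
      ((min ‖nthRoot 2 U - nthRoot 2 Z‖ ‖nthRoot 2 U + nthRoot 2 Z‖) ^ 2)⁻¹)
    (hQ : Q = Dn / (‖g‖ * calN d n) *
      (max ‖nthRoot 2 U - nthRoot 2 Z‖ ‖nthRoot 2 U + nthRoot 2 Z‖) ^ 2)
    (hκ : κ = Real.log Q / Real.log E)
    (hc : c = 4 * h * ‖nthRoot 2 τ‖ * (‖x - β₁‖ + ‖x - β₂‖) * Cn * Q *
      (max 1 (5 * h * ‖nthRoot 2 τ‖ * ‖1 - ω‖ * ‖x - β₂‖ * ‖A - β₁‖ * Cn * E)) ^ κ)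
    (hE_one : 1 < E)
    (hW_cond : (W.im = 0 ∧ 0 < W.re ∧ W.re < 1) ∨ (‖W‖ = 1 ∧ W ≠ -1)) :
    -- `𝒜(x)` is well defined, and the irrationality measure holds
    (x - β₂) * ω - (x - β₁) ≠ 0 ∧
    ∀ p q : ℂ, p ∈ K → q ∈ K → IsIntegral ℤ p → IsIntegral ℤ q → q ≠ 0 →
      1 / (c * ‖q‖ ^ (κ + 1)) < ‖A - p / q‖ := by
  have hd0 : 0 < d := hd.1.1
  have hdg : IsIntegral ℤ ((U - Z) / ((d : ℂ) * g)) := hd.1.2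
  have hW0 : W ≠ 0 := by
    rintro rfl
    rcases hW_cond with ⟨-, h1, -⟩ | ⟨h1, -⟩ <;> simp at h1
  have hU0 : U ≠ 0 := by
    rintro rfl
    exact hW0 (by rw [hW, div_zero])
  have hZ0 : Z ≠ 0 := by
    rintro rfl
    exact hW0 (by rw [hW, zero_div])
  have hUZ : U ≠ Z := by
    rintro rfl
    have h1 : d + 1 ≤ d := hd.2 ⟨Nat.succ_pos d, by rw [sub_self, zero_div]; exact isIntegral_zero⟩
    omega
  have hxβ₁ : x - β₁ ≠ 0 := fun h0 => hZ0 (by rw [hZ, h0, zero_pow (by omega), mul_zero])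
  have hxβ₂ : x - β₂ ≠ 0 := fun h0 => hU0 (by rw [hU, h0, zero_pow (by omega), mul_zero])
  obtain ⟨hβ, hβ₂, hUZsq, hsq⟩ := sq_mem_of_conjugate hβ₁ hdeg h_deg_one h_deg_two hxK hU hZ
  have hT : 1 ≤ ‖nthRoot 2 τ‖ := one_le_norm_nthRoot_two hK hτ_one hτ
  have hcal := calN_pos d n
  have hD : 0 < Dn / calN d n := div_pos hDn hcal
  have hg' : 0 < ‖g‖ := norm_pos_iff.2 hg
  have hDN : ∀ r, 0 ≤ (denomX n r : ℝ) / numerX d n r := fun r => by positivity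
  have hγ₀ : ∀ r, (denomX n r : ℝ) / numerX d n r ≤ Cn * (Dn / calN d n) ^ r := fun r => by
    refine le_trans ?_ (hCD r).le
    exact le_mul_of_one_le_left (hDN r) (le_max_left _ _)
  have hγ₁ : ∀ r : ℕ, Real.Gamma (1 - 1 / (n : ℝ)) * r.factorial /
      Real.Gamma ((r : ℝ) + 1 - 1 / (n : ℝ)) * ((denomX n r : ℝ) / numerX d n r)
        ≤ Cn * (Dn / calN d n) ^ r := fun r => by
    refine le_trans ?_ (hCD r).le
    exact mul_le_mul_of_nonneg_right ((le_max_left _ _).trans (le_max_right _ _)) (hDN r)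
  have hγ₂ : ∀ r : ℕ, n * Real.Gamma ((r : ℝ) + 1 + 1 / (n : ℝ)) /
      (Real.Gamma (1 / (n : ℝ)) * r.factorial) * ((denomX n r : ℝ) / numerX d n r)
        ≤ Cn * (Dn / calN d n) ^ r := fun r => by
    refine le_trans ?_ (hCD r).le
    exact mul_le_mul_of_nonneg_right ((le_max_right _ _).trans (le_max_right _ _)) (hDN r)
  set M := max ‖nthRoot 2 U - nthRoot 2 Z‖ ‖nthRoot 2 U + nthRoot 2 Z‖ ^ 2 with hM
  set m := min ‖nthRoot 2 U - nthRoot 2 Z‖ ‖nthRoot 2 U + nthRoot 2 Z‖ ^ 2 with hm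
  -- `E > 1` excludes `m = 0`, where `E` would be `0`
  have hm0 : 0 < m := by
    refine lt_of_le_of_ne (by positivity) fun h0 => ?_
    rw [← h0, inv_zero, mul_zero] at hE
    linarith
  have hM0 : 0 < M := by
    refine hm0.trans_le ?_
    rw [hM, hm]
    gcongr
    exact min_le_max
  have hE' : E = ‖g‖ / (Dn / calN d n) * m⁻¹ := by rw [hE, div_div_eq_mul_div]
  have hQ' : Q = Dn / calN d n / ‖g‖ * M := by rw [hQ, div_div, mul_comm ‖g‖]
  rw [hc, hκ]
  rcases hW_cond with ⟨him, hre0, hre1⟩ | ⟨hW1, -⟩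
  · set y := √W.re with hy
    have hy0 : 0 < y := Real.sqrt_pos.2 hre0
    have hysq : y ^ 2 = W.re := Real.sq_sqrt hre0.le
    have hy1 : y < 1 := by nlinarith
    have hWy : W = (y : ℂ) ^ 2 := by
      rw [← Complex.ofReal_pow, hysq]
      exact Complex.ext (by simp) (by simp [him])
    have hZy : Z = (y : ℂ) ^ 2 * U := by
      rw [← hWy, hW, div_mul_cancel₀ _ hU0]
    -- `E > 1` keeps `W` away from `0`: `6 / 5 ≤ d * Dn / calN d n < (1 - y ^ 2) / (1 - y) ^ 2`
    have hy18 : 1 / 18 ≤ y := by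
      have h65 := six_fifths_le_mul_of_denomX_div_numerX_le hn hd0 hD hγ₀
      have hle := mul_norm_le_norm_sub hK hd0 hg hUZ hUZsq hdg hseq_spec
      have hUy : ‖U - Z‖ = ‖U‖ * (1 - y ^ 2) := by
        rw [hZy, show U - (y : ℂ) ^ 2 * U = U * ((1 - y ^ 2 : ℝ) : ℂ) by push_cast; ring,
          norm_mul, Complex.norm_real, Real.norm_of_nonneg (by nlinarith)]
      have hmy : m = ‖U‖ * (1 - y) ^ 2 := by
        have h2 := (max_min_of_sq_eq_mul (s := nthRoot 2 U) (t := nthRoot 2 Z) hy0.le hy1.le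
          (by rw [nthRoot_two_sq, nthRoot_two_sq, hZy])).2
        rw [hm, h2, mul_pow, ← norm_pow, nthRoot_two_sq]
      have hEm : Dn / calN d n * m < ‖g‖ := by
        rw [hE', ← div_eq_mul_inv, lt_div_iff₀ hm0, one_mul, lt_div_iff₀ hD] at hE_one
        linarith
      have hd' : (0 : ℝ) < d := by exact_mod_cast hd0
      have hU' : 0 < ‖U‖ := norm_pos_iff.2 hU0
      have h1 : 6 / 5 * m ≤ Dn / calN d n * d * m := by gcongr
      have h2 : d * (Dn / calN d n * m) < d * ‖g‖ := by gcongr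
      have h3 : 6 / 5 * m < ‖U‖ * (1 - y ^ 2) := by rw [← hUy]; linarith
      rw [hmy] at h3
      have h4 : ‖U‖ * (1 - y) * (6 / 5 * (1 - y)) < ‖U‖ * (1 - y) * (1 + y) := by linarith
      have h5 := lt_of_mul_lt_mul_left h4 (mul_nonneg hU'.le (by linarith))
      linarith
    have hb := fun r => norm_hypForm_bounds_of_real hn hU0 hy18 hy1 hZy (nthRoot_two_sq U)
      (nthRoot_two_sq Z) r
    simp only [← hW, ← hω, ← hM, ← hm] at hb
    exact nonzero_and_lt_norm_sub_div hK hn hd0 hβ hxβ₁ hxβ₂ hU0 hZ0 hUZ hβ₁ hβ₂ hx hsq hA hg hUg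
      hZg hdg hh hseq_spec hCn hD hM0 hm0 hT hγ₁ hγ₂ (kA := 3) (kR := 1) (by norm_num)
      (by norm_num) (by norm_num) (fun r => (hb r).1) (fun r => (hb r).2.1)
      (fun r => by rw [one_mul]; exact (hb r).2.2) hE' hQ' hE_one
  · have hb := fun r => norm_hypForm_bounds_of_norm_eq (by omega : 2 ≤ n) hU0 (hW ▸ hW1)
      (nthRoot_two_sq U) (nthRoot_two_sq Z) r
    simp only [← hW, ← hω, ← hM, ← hm] at hb
    exact nonzero_and_lt_norm_sub_div hK hn hd0 hβ hxβ₁ hxβ₂ hU0 hZ0 hUZ hβ₁ hβ₂ hx hsq hA hg hUg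
      hZg hdg hh hseq_spec hCn hD hM0 hm0 hT hγ₁ hγ₂ (kA := 1) (kR := 2) (by norm_num)
      (by norm_num) (by norm_num) (fun r => by rw [one_mul]; exact (hb r).1)
      (fun r => by rw [one_mul]; exact (hb r).2.1) (fun r => (hb r).2.2) hE' hQ' hE_one
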